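/- Let $\eta>0$, $T>0$, and let $f^{\mathrm{in}}\in L^1([0,\infty))$ satisfy $f^{\mathrm{in}}\ge 0$ a.e. Consider the nonlocal diffusion problem $$\partial_t f(t,x)=\frac{\eta}{3}\Big(\int_0^\infty f(t,x_*)\,dx_*\Big)\partial_x^2 f(t,x),\qquad f(t,0)=0,\qquad f(0,x)=f^{\mathrm{in}}(x),\tag{P}$$ for $t\in[0,T]$, $x\in[0,\infty)$. Let $\mathcal T$ be the set of all $\varphi\in C^1([0,T];C^2([0,\infty)))$ (that is, $\partial_x^k\varphi$ and $\partial_x^k\partial_t\varphi$ exist and are jointly continuous on $[0,T]\times[0,\infty)$ for $k=0,1,2$) such that $\varphi,\partial_t\varphi,\partial_x^2\varphi$ are bounded, $\varphi(T,x)=0$ for all $x\ge 0$, and $\varphi(t,0)=0$ for all $t\in[0,T]$. A function $f\in L^1([0,T]\times[0,\infty))$ is a very weak solution of (P) if for every $\varphi\in\mathcal T$ the function $t\mapsto \int_0^\infty f(t,x_*)\,dx_*\int_0^\infty f(t,x)\,\partial_x^2\varphi(t,x)\,dx$ is integrable on $[0,T]$ and $$\int_0^T\!\!\int_0^\infty f\,\partial_t\varphi\,dx\,dt+\frac{\eta}{3}\int_0^T\Big(\int_0^\infty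 f(t,x_*)\,dx_*\Big)\int_0^\infty f(t,x)\,\partial_x^2\varphi(t,x)\,dx\,dt+\int_0^\infty f^{\mathrm{in}}(x)\,\varphi(0,x)\,dx=0.$$ Then there exists a very weak solution $f$ of (P) with $f\ge 0$ a.e. on $[0,T]\times[0,\infty)$, and it is unique: any two a.e. non-negative very weak solutions of (P) coincide a.e. on $[0,T]\times[0,\infty)$. -/

import Mathlib

open MeasureTheory Set

noncomputable section

namespace NonlocalDiffusion

/-- The time derivative `∂ₜφ(t, x)` of a function on `[0, T] × [0, ∞)`
(one-sided at `t = 0` and `t = T`). -/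
def timeDeriv (T : ℝ) (φ : ℝ → ℝ → ℝ) (t x : ℝ) : ℝ :=
  derivWithin (fun s => φ s x) (Icc 0 T) t

/-- The `k`-th space derivative `∂ₓᵏφ(t, x)` of a function on `[0, T] × [0, ∞)`
(one-sided at `x = 0`). -/
def spaceDeriv (k : ℕ) (φ : ℝ → ℝ → ℝ) (t x : ℝ) : ℝ :=
  iteratedDerivWithin k (φ t) (Ici 0) x

/-- The space-time strip `[0, T] × [0, ∞)`. -/
def strip (T : ℝ) : Set (ℝ × ℝ) := Icc 0 T ×ˢ Ici 0

/-- Test functions for the Dirichlet problem on the half-line. The first five fields say that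
`φ ∈ C¹([0, T]; C²([0, ∞)))`, i.e. `∂ₓᵏφ` and `∂ₓᵏ∂ₜφ` exist and are jointly continuous on
`[0, T] × [0, ∞)` for `k = 0, 1, 2`; the sixth one is boundedness of `φ` and of the two derivatives
which are integrated against `L¹` functions. -/
structure IsTestFunction (T : ℝ) (φ : ℝ → ℝ → ℝ) : Prop where
  contDiffOn_space : ∀ t ∈ Icc 0 T, ContDiffOn ℝ 2 (φ t) (Ici 0)
  differentiableOn_time : ∀ x ∈ Ici (0 : ℝ), DifferentiableOn ℝ (fun t => φ t x) (Icc 0 T)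
  contDiffOn_timeDeriv : ∀ t ∈ Icc 0 T, ContDiffOn ℝ 2 (timeDeriv T φ t) (Ici 0)
  continuousOn_spaceDeriv : ∀ k ≤ 2,
    ContinuousOn (fun p : ℝ × ℝ => spaceDeriv k φ p.1 p.2) (strip T)
  continuousOn_mixedDeriv : ∀ k ≤ 2,
    ContinuousOn (fun p : ℝ × ℝ => spaceDeriv k (timeDeriv T φ) p.1 p.2) (strip T)
  bounded : ∃ C : ℝ, ∀ t ∈ Icc 0 T, ∀ x ∈ Ici (0 : ℝ),
    |φ t x| ≤ C ∧ |timeDeriv T φ t x| ≤ C ∧ |spaceDeriv 2 φ t x| ≤ C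
  terminal : ∀ x ∈ Ici (0 : ℝ), φ T x = 0
  dirichlet : ∀ t ∈ Icc 0 T, φ t 0 = 0

/-- The total mass `∫₀^∞ f(t, x) dx` at time `t`. -/
def mass (f : ℝ → ℝ → ℝ) (t : ℝ) : ℝ := ∫ x in Ici (0 : ℝ), f t x

/-- Very weak solutions on `[0, T] × [0, ∞)` of
`∂ₜf = (η / 3) (∫₀^∞ f(t, y) dy) ∂ₓ²f`, `f(t, 0) = 0`, `f(0, ·) = fin`. The field
`integrable_diffusion` says that the time integral of the nonlinear term in the weak formulation
makes sense; for the other two terms this follows from `f, fin ∈ L¹`. -/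
structure IsVeryWeakSolution (η T : ℝ) (fin : ℝ → ℝ) (f : ℝ → ℝ → ℝ) : Prop where
  integrable : IntegrableOn (fun p : ℝ × ℝ => f p.1 p.2) (strip T)
  integrable_diffusion : ∀ φ, IsTestFunction T φ →
    IntegrableOn (fun t => mass f t * ∫ x in Ici (0 : ℝ), f t x * spaceDeriv 2 φ t x) (Icc 0 T)
  weak_eq : ∀ φ, IsTestFunction T φ →
    (∫ t in Icc 0 T, ∫ x in Ici (0 : ℝ), f t x * timeDeriv T φ t x)
      + η / 3 * (∫ t in Icc 0 T,
          mass f t * ∫ x in Ici (0 : ℝ), f t x * spaceDeriv 2 φ t x)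
      + (∫ x in Ici (0 : ℝ), fin x * φ 0 x) = 0

/-- Non-negativity almost everywhere on `[0, T] × [0, ∞)`. -/
def IsNonnegative (T : ℝ) (f : ℝ → ℝ → ℝ) : Prop :=
  ∀ᵐ p : ℝ × ℝ ∂(volume.restrict (strip T)), 0 ≤ f p.1 p.2

end NonlocalDiffusion

end

noncomputable section

namespace NonlocalDiffusion

open Filter Topology ProbabilityTheory

/-! The equation is the Dirichlet heat equation run on the clock `τ(t) = (η/3) ∫₀ᵗ m(s) ds`, with
`m` the mass of `f`. If `u` is the heat flow from `fin` and `M` its mass, a non-negative solution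
has to be `f(t, x) = u(τ(t), x)` with `τ' = (η/3) M(τ)`, `τ(0) = 0`, so the problem reduces to this
scalar equation.

Uniqueness: testing with `θ(t) sin(ξ x)` shows that the sine transform of `f(t, ·)` solves a linear
equation in `t`, hence equals that of `fin` times `exp(-ξ² τ(t))`
(`IsVeryWeakSolution.sine_transform_eq`). The sine transform is injective on non-negative integrable
functions (`ae_eq_of_sine_transform_eq`), so `f(t, ·) = u(τ(t), ·)` and `m = M(τ)` for almost every
`t`. Since `M` is nonincreasing, two such clocks coincide (`le_of_integral_antitone`), and so do the
solutions.

Existence: `u` is given by the method of images. A reflection argument (`mass_heatSol`) writes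
`M(τ)` as a Gaussian average of tails of `fin`, so `M` is nonincreasing, continuous, bounded, and
positive unless `fin = 0`; separation of variables then produces `τ` (`exists_isTimeChange`). The
weak formulation is checked by duality: for each `y > 0`, the kernel started at `y` and tested with
`∂ₜφ + τ' ∂ₓ²φ` gives `-φ(0, y)` (`IsTimeChange.integral_kernelTest_eq`), which is then integrated
against `fin`. -/

/-! ### Linear integral equations and weak derivatives in time. -/

/-- An absolutely continuous function is bounded by some `C` on the interval, and `exp` is Lipschitz
with constant `exp C` on `(-∞, C]`. -/
theorem absolutelyContinuousOnInterval_exp_comp {f : ℝ → ℝ} {a b : ℝ}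
    (hf : AbsolutelyContinuousOnInterval f a b) :
    AbsolutelyContinuousOnInterval (fun x => Real.exp (f x)) a b := by
  obtain ⟨C, hC⟩ := hf.exists_bound
  have hlip : ∀ x ∈ uIcc a b, ∀ y ∈ uIcc a b,
      dist (Real.exp (f x)) (Real.exp (f y)) ≤ Real.exp C * dist (f x) (f y) := by
    intro x hx y hy
    refine Convex.norm_image_sub_le_of_norm_deriv_le (s := Iic C) (f := Real.exp)
      (fun z _ => Real.differentiableAt_exp) (fun z hz => ?_) (convex_Iic C) ?_ ?_
    · simpa using hz
    · exact (le_abs_self _).trans (hC y hy)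
    · exact (le_abs_self _).trans (hC x hx)
  rw [absolutelyContinuousOnInterval_iff] at hf ⊢
  intro ε hε
  obtain ⟨δ, hδ, h⟩ := hf (ε / Real.exp C) (by positivity)
  refine ⟨δ, hδ, fun E hE hlt => ?_⟩
  have h1 := h E hE hlt
  rw [lt_div_iff₀ (Real.exp_pos C)] at h1
  refine lt_of_le_of_lt ?_ h1
  rw [mul_comm, Finset.mul_sum]
  exact Finset.sum_le_sum fun i hi => hlip _ (hE.1 i hi).1 _ (hE.1 i hi).2

/-- The linear integral equation `G r = c - ∫₀ʳ b G` with an integrable coefficient. -/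
theorem eq_mul_exp_of_eq_sub_integral {b G : ℝ → ℝ} {c s : ℝ}
    (hb : IntervalIntegrable b volume 0 s)
    (hbG : IntervalIntegrable (fun r => b r * G r) volume 0 s)
    (hG : ∀ r ∈ uIcc 0 s, G r = c - ∫ v in (0 : ℝ)..r, b v * G v) :
    G s = c * Real.exp (-∫ v in (0 : ℝ)..s, b v) := by
  set B : ℝ → ℝ := fun r => ∫ v in (0 : ℝ)..r, b v with hB
  set J : ℝ → ℝ := fun r => ∫ v in (0 : ℝ)..r, b v * G v with hJ
  have hBac : AbsolutelyContinuousOnInterval B 0 s :=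
    hb.absolutelyContinuousOnInterval_intervalIntegral left_mem_uIcc
  have hJac : AbsolutelyContinuousOnInterval J 0 s :=
    hbG.absolutelyContinuousOnInterval_intervalIntegral left_mem_uIcc
  have hcac : AbsolutelyContinuousOnInterval (fun _ : ℝ => c) 0 s :=
    contDiffOn_const.absolutelyContinuousOnInterval
  -- Integrating factor: the derivatives exist only almost everywhere, so absolute continuity is
  -- what makes a product with zero derivative constant.
  have hPac : AbsolutelyContinuousOnInterval (fun r => (c - J r) * Real.exp (B r)) 0 s :=
    (hcac.fun_sub hJac).fun_mul (absolutelyContinuousOnInterval_exp_comp hBac)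
  obtain ⟨C, hC⟩ := hPac.const_of_ae_hasDerivAt_zero (by
    filter_upwards [hb.ae_hasDerivAt_integral, hbG.ae_hasDerivAt_integral] with x h1 h2 hx
    have d1 := h1 hx 0 left_mem_uIcc
    have d2 := h2 hx 0 left_mem_uIcc
    have := (d2.const_sub c).mul d1.exp
    refine this.congr_deriv ?_
    rw [hG x hx]
    ring)
  have h0 := hC 0 left_mem_uIcc
  have hs := hC s right_mem_uIcc
  simp only [hJ, hB, intervalIntegral.integral_same, Real.exp_zero, sub_zero, mul_one] at h0
  rw [hG s right_mem_uIcc, Real.exp_neg, ← div_eq_mul_inv, eq_div_iff (Real.exp_pos _).ne']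
  exact hs.trans h0.symm

/-- A du Bois-Reymond lemma: the weak form of `F' = -H`, `F 0 = c` on `[0, T]`, tested against
primitives of continuous functions vanishing at `T`. -/
theorem ae_eq_sub_integral_of_weak {T c : ℝ} (hT : 0 < T) {F H : ℝ → ℝ}
    (hF : IntegrableOn F (Icc 0 T)) (hH : IntegrableOn (fun t => (T - t) * H t) (Icc 0 T))
    (hw : ∀ ψ : ℝ → ℝ, Continuous ψ →
      (∫ t in Icc 0 T, F t * ψ t) + ∫ t in Icc 0 T, H t * ∫ s in t..T, ψ s
        = c * ∫ s in (0 : ℝ)..T, ψ s) :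
    ∀ᵐ t ∂(volume.restrict (Icc 0 T)), F t = c - ∫ s in (0 : ℝ)..t, H s := by
  set μ : Measure ℝ := volume.restrict (Icc 0 T) with hμ
  have hmem : ∀ᵐ t ∂μ, t ∈ Icc 0 T := ae_restrict_mem measurableSet_Icc
  have hneT : ∀ᵐ t ∂μ, t ≠ T := by
    rw [ae_iff]; simp
  have hHm : AEStronglyMeasurable H μ := by
    have h1 : AEStronglyMeasurable (fun t => (T - t)⁻¹ * ((T - t) * H t)) μ :=
      ((by fun_prop : Measurable fun t : ℝ => (T - t)⁻¹).aestronglyMeasurable).mul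
        hH.aestronglyMeasurable
    refine h1.congr ?_
    filter_upwards [hneT] with t ht
    have : T - t ≠ 0 := sub_ne_zero.2 ht.symm
    field_simp
  set D : Set (ℝ × ℝ) := {p | p.1 ≤ p.2} with hD
  have hDm : MeasurableSet D := measurableSet_le measurable_fst measurable_snd
  have hint : ∀ t ∈ Icc 0 T, ∀ g : ℝ → ℝ,
      ∫ s, D.indicator (fun p => g p.2) (t, s) ∂μ = ∫ s in t..T, g s := by
    intro t ht g
    have : (fun s => D.indicator (fun p : ℝ × ℝ => g p.2) (t, s)) = (Ici t).indicator g := by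
      ext s; simp [indicator, hD]
    rw [this, integral_indicator measurableSet_Ici, hμ, Measure.restrict_restrict measurableSet_Ici,
      intervalIntegral.integral_of_le ht.2, ← integral_Icc_eq_integral_Ioc]
    congr 2
    ext s; simp only [mem_inter_iff, mem_Ici, mem_Icc]
    constructor
    · rintro ⟨h1, h2⟩; exact ⟨h1, h2.2⟩
    · rintro ⟨h1, h2⟩; exact ⟨h1, ht.1.trans h1, h2⟩
  -- On the triangle `t ≤ s ≤ T` the section over `t` has length `T - t`. The weighted integrability
  -- of `H` is therefore exactly what Fubini requires; `H` itself may fail to be integrable near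
  -- `T`.
  have hK : Integrable (fun p : ℝ × ℝ => H p.1 * D.indicator (fun _ => (1 : ℝ)) p) (μ.prod μ) := by
    have hKm : AEStronglyMeasurable (fun p : ℝ × ℝ => H p.1 * D.indicator (fun _ => (1 : ℝ)) p)
        (μ.prod μ) :=
      hHm.comp_fst.mul (measurable_const.indicator hDm).aestronglyMeasurable
    rw [integrable_prod_iff hKm]
    constructor
    · refine Eventually.of_forall fun t => ?_
      refine (Integrable.const_mul ?_ (H t))
      exact Integrable.indicator (s := {s | t ≤ s}) (integrable_const (1 : ℝ)) measurableSet_Ici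
    · refine hH.norm.congr ?_
      filter_upwards [hmem] with t ht
      have h2 := hint t ht fun _ => 1
      have h3 : ∀ s, ‖H t * D.indicator (fun _ => (1 : ℝ)) (t, s)‖
          = |H t| * D.indicator (fun _ => (1 : ℝ)) (t, s) := by
        intro s
        rw [norm_mul, Real.norm_eq_abs, Real.norm_of_nonneg]
        exact indicator_nonneg (fun _ _ => zero_le_one) _
      simp_rw [h3]
      rw [integral_const_mul, h2]
      simp [abs_of_nonneg (sub_nonneg.2 ht.2), mul_comm]
  have hKint : Integrable (fun s => ∫ t, H t * D.indicator (fun _ => (1 : ℝ)) (t, s) ∂μ) μ :=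
    hK.integral_prod_right
  have hKeq : ∀ s ∈ Icc 0 T, ∫ t, H t * D.indicator (fun _ => (1 : ℝ)) (t, s) ∂μ
      = ∫ t in (0 : ℝ)..s, H t := by
    intro s hs
    have : (fun t => H t * D.indicator (fun _ => (1 : ℝ)) (t, s)) = (Iic s).indicator H := by
      ext t; simp [indicator, hD]
    rw [this, integral_indicator measurableSet_Iic, hμ, Measure.restrict_restrict measurableSet_Iic,
      intervalIntegral.integral_of_le hs.1, ← integral_Icc_eq_integral_Ioc]
    congr 2
    ext t; simp only [mem_inter_iff, mem_Iic, mem_Icc]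
    constructor
    · rintro ⟨h1, h2⟩; exact ⟨h2.1, h1⟩
    · rintro ⟨h1, h2⟩; exact ⟨h2, h1, h2.trans hs.2⟩
  have hR : Integrable
      (fun s => F s + (∫ t, H t * D.indicator (fun _ => (1 : ℝ)) (t, s) ∂μ) - c) μ :=
    (hF.add hKint).sub (integrable_const c)
  have key := ae_eq_zero_of_integral_contDiff_smul_eq_zero hR.locallyIntegrable (by
    intro ψ hψ hsupp
    obtain ⟨C, hC⟩ := hsupp.exists_bound_of_continuous hψ.continuous
    have e1 : ∫ t, H t * (∫ s in t..T, ψ s) ∂μ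
        = ∫ s, ψ s * ∫ t, H t * D.indicator (fun _ => (1 : ℝ)) (t, s) ∂μ ∂μ := by
      have hKψ : Integrable (Function.uncurry fun t s =>
          H t * D.indicator (fun _ => (1 : ℝ)) (t, s) * ψ s) (μ.prod μ) :=
        hK.mul_bdd (c := C)
          (hψ.continuous.comp continuous_snd).aestronglyMeasurable
          (Eventually.of_forall fun p => hC p.2)
      calc ∫ t, H t * (∫ s in t..T, ψ s) ∂μ
          = ∫ t, ∫ s, H t * D.indicator (fun _ => (1 : ℝ)) (t, s) * ψ s ∂μ ∂μ := by
            refine integral_congr_ae ?_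
            filter_upwards [hmem] with t ht
            rw [← hint t ht ψ, ← integral_const_mul]
            congr 1
            ext s
            by_cases h : (t, s) ∈ D <;> simp [h]
        _ = ∫ s, ∫ t, H t * D.indicator (fun _ => (1 : ℝ)) (t, s) * ψ s ∂μ ∂μ :=
            integral_integral_swap hKψ
        _ = _ := by
            congr 1
            ext s
            rw [integral_mul_const, mul_comm]
    have hw' := hw ψ hψ.continuous
    have hψc : AEStronglyMeasurable ψ μ := hψ.continuous.aestronglyMeasurable
    have i1 : Integrable (fun s => F s * ψ s) μ :=
      Integrable.mul_bdd (c := C) hF hψc (Eventually.of_forall hC)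
    have i2 : Integrable (fun s => ψ s * ∫ t, H t * D.indicator (fun _ => (1 : ℝ)) (t, s) ∂μ) μ :=
      hKint.bdd_mul (c := C) hψc (Eventually.of_forall hC)
    have i3 : Integrable ψ μ := by
      simpa using (integrable_const (1 : ℝ)).bdd_mul (c := C) (μ := μ) hψc (Eventually.of_forall hC)
    rw [e1, intervalIntegral.integral_of_le hT.le, ← integral_Icc_eq_integral_Ioc] at hw'
    calc ∫ s, ψ s • (F s + (∫ t, H t * D.indicator (fun _ => (1 : ℝ)) (t, s) ∂μ) - c) ∂μ
        = ∫ s, (F s * ψ s + ψ s * (∫ t, H t * D.indicator (fun _ => (1 : ℝ)) (t, s) ∂μ))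
            - c * ψ s ∂μ := by
          congr 1; ext s; simp only [smul_eq_mul]; ring
      _ = 0 := by
          have i4 : Integrable (fun s => F s * ψ s
              + ψ s * ∫ t, H t * D.indicator (fun _ => (1 : ℝ)) (t, s) ∂μ) μ := i1.add i2
          rw [integral_sub i4 (i3.const_mul c), integral_add i1 i2, integral_const_mul,
            ← hw']
          ring)
  filter_upwards [key, hmem] with s hs hs'
  rw [hKeq s hs'] at hs
  linarith

/-! ### Injectivity of the sine transform and comparison of clocks. -/

/-- The sine transform is injective on nonnegative integrable functions on the half-line. -/
theorem ae_eq_of_sine_transform_eq {g h : ℝ → ℝ} (hg : IntegrableOn g (Ici 0))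
    (hh : IntegrableOn h (Ici 0)) (hg0 : ∀ᵐ x ∂(volume.restrict (Ici (0 : ℝ))), 0 ≤ g x)
    (hh0 : ∀ᵐ x ∂(volume.restrict (Ici (0 : ℝ))), 0 ≤ h x)
    (heq : ∀ ξ : ℝ, ∫ x in Ici (0 : ℝ), g x * Real.sin (ξ * x)
      = ∫ x in Ici (0 : ℝ), h x * Real.sin (ξ * x)) :
    ∀ᵐ x ∂(volume.restrict (Ici (0 : ℝ))), g x = h x := by
  set μ : Measure ℝ := volume.restrict (Ici (0 : ℝ)) with hμ
  set P : (ℝ → ℝ) → Measure ℝ := fun u => μ.withDensity fun x => ENNReal.ofReal (u x) with hP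
  have hfin : ∀ u, IntegrableOn u (Ici 0) → IsFiniteMeasure (P u) := fun u hu =>
    isFiniteMeasure_withDensity_ofReal hu.hasFiniteIntegral
  have := hfin g hg
  have := hfin h hh
  have hchar : ∀ u, IntegrableOn u (Ici 0) → (∀ᵐ x ∂μ, 0 ≤ u x) → ∀ ξ, charFun (P u) ξ
      = ((∫ x, u x * Real.cos (ξ * x) ∂μ : ℝ) : ℂ)
        + ((∫ x, u x * Real.sin (ξ * x) ∂μ : ℝ) : ℂ) * Complex.I := by
    intro u hu hu0 ξ
    rw [charFun_apply_real, hP]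
    simp only
    rw [integral_withDensity_eq_integral_toReal_smul₀ hu.aemeasurable.ennreal_ofReal
      (Eventually.of_forall fun _ => ENNReal.ofReal_lt_top)]
    have ic : Integrable (fun x => u x * Real.cos (ξ * x)) μ :=
      hu.mul_bdd (c := 1) (by fun_prop) (Eventually.of_forall fun x => Real.abs_cos_le_one _)
    have is : Integrable (fun x => u x * Real.sin (ξ * x)) μ :=
      hu.mul_bdd (c := 1) (by fun_prop) (Eventually.of_forall fun x => Real.abs_sin_le_one _)
    rw [← integral_complex_ofReal, ← integral_complex_ofReal, ← integral_mul_const,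
      ← integral_add ic.ofReal (is.ofReal.mul_const _)]
    refine integral_congr_ae ?_
    filter_upwards [hu0] with x hx
    rw [ENNReal.toReal_ofReal hx, Complex.real_smul, Complex.exp_mul_I]
    push_cast
    ring
  have hcharneg : ∀ u, IntegrableOn u (Ici 0) → (∀ᵐ x ∂μ, 0 ≤ u x) → ∀ ξ,
      charFun ((P u).map Neg.neg) ξ
      = ((∫ x, u x * Real.cos (ξ * x) ∂μ : ℝ) : ℂ)
        - ((∫ x, u x * Real.sin (ξ * x) ∂μ : ℝ) : ℂ) * Complex.I := by
    intro u hu hu0 ξ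
    have : charFun ((P u).map Neg.neg) ξ = charFun (P u) (-ξ) := by
      rw [charFun_apply_real, charFun_apply_real, integral_map (by fun_prop) (by fun_prop)]
      congr 1; ext x; push_cast; ring_nf
    rw [this, hchar u hu hu0]
    simp only [neg_mul, Real.cos_neg, Real.sin_neg, mul_neg, integral_neg]
    push_cast
    ring
  -- Reflection changes the sign of the sine part only. When the sine transforms agree, both sides
  -- have as characteristic function the sum of the two cosine transforms.
  have hmeas : P g + (P h).map Neg.neg = P h + (P g).map Neg.neg := by
    have : IsFiniteMeasure ((P g).map Neg.neg) := inferInstance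
    refine Measure.ext_of_charFun ?_
    ext ξ
    have ca : ∀ (m n : Measure ℝ) [IsFiniteMeasure m] [IsFiniteMeasure n],
        charFun (m + n) ξ = charFun m ξ + charFun n ξ := by
      intro m n _ _
      simp only [charFun_apply_real]
      refine integral_add_measure ?_ ?_
      · refine Integrable.of_bound (by fun_prop) 1 (Eventually.of_forall fun x => ?_)
        rw [← Complex.ofReal_mul, Complex.norm_exp_ofReal_mul_I]
      · refine Integrable.of_bound (by fun_prop) 1 (Eventually.of_forall fun x => ?_)
        rw [← Complex.ofReal_mul, Complex.norm_exp_ofReal_mul_I]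
    rw [ca, ca, hchar g hg hg0, hchar h hh hh0, hcharneg g hg hg0, hcharneg h hh hh0, heq ξ]
    ring
  -- The reflected measures do not charge `(0, ∞)`, so restricting the identity to it separates `P
  -- g` from `P h`.
  have hz : ∀ u, ((P u).map Neg.neg).restrict (Ioi 0) = 0 := by
    intro u
    rw [Measure.restrict_eq_zero, Measure.map_apply measurable_neg measurableSet_Ioi, hP]
    refine withDensity_absolutelyContinuous _ _ ?_
    rw [hμ, Measure.restrict_apply (measurable_neg measurableSet_Ioi)]
    have : Neg.neg ⁻¹' Ioi (0 : ℝ) ∩ Ici 0 = ∅ := by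
      ext x; simp
    rw [this, measure_empty]
  have hr := congrArg (fun m => Measure.restrict m (Ioi 0)) hmeas
  simp only [Measure.restrict_add, hz, add_zero] at hr
  have hres : ∀ u, (P u).restrict (Ioi 0) = P u := by
    intro u
    rw [hP]
    simp only
    rw [restrict_withDensity measurableSet_Ioi, hμ, Measure.restrict_restrict measurableSet_Ioi]
    congr 1
    rw [inter_eq_left.2 Ioi_subset_Ici_self]
    exact restrict_Ioi_eq_restrict_Ici
  rw [hres, hres] at hr
  have := (withDensity_eq_iff hg.aemeasurable.ennreal_ofReal hh.aemeasurable.ennreal_ofReal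
    (by
      have := hg.lintegral_lt_top
      exact this.ne)).1 hr
  filter_upwards [this, hg0, hh0] with x h1 h2 h3
  exact (ENNReal.ofReal_eq_ofReal_iff h2 h3).1 h1

/-- Forward uniqueness for `τ' = c M(τ)`, `τ(0) = 0`, with `M` nonincreasing. -/
theorem le_of_integral_antitone {T c : ℝ} (hc : 0 ≤ c) {M τ σ m n : ℝ → ℝ} (hM : Antitone M)
    (hm : IntegrableOn m (Icc 0 T)) (hn : IntegrableOn n (Icc 0 T))
    (hτ : ∀ t ∈ Icc 0 T, τ t = c * ∫ s in (0 : ℝ)..t, m s)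
    (hσ : ∀ t ∈ Icc 0 T, σ t = c * ∫ s in (0 : ℝ)..t, n s)
    (hmM : ∀ᵐ t ∂(volume.restrict (Icc 0 T)), m t = M (τ t))
    (hnM : ∀ᵐ t ∂(volume.restrict (Icc 0 T)), n t = M (σ t)) :
    ∀ t ∈ Icc 0 T, τ t ≤ σ t := by
  intro t ht
  by_contra! hlt
  have hcont : ∀ {m : ℝ → ℝ} {τ : ℝ → ℝ}, IntegrableOn m (Icc 0 T) →
      (∀ t ∈ Icc 0 T, τ t = c * ∫ s in (0 : ℝ)..t, m s) → ContinuousOn τ (Icc 0 t) := by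
    intro m τ hm hτ
    refine ContinuousOn.congr (f := fun t => c * ∫ s in (0 : ℝ)..t, m s) ?_
      (fun s hs => hτ s ⟨hs.1, hs.2.trans ht.2⟩)
    refine continuousOn_const.mul ?_
    have := intervalIntegral.continuousOn_primitive_interval (f := m) (a := 0) (b := T)
      (μ := volume) (by rwa [uIcc_of_le (ht.1.trans ht.2)])
    refine this.mono ?_
    rw [uIcc_of_le (ht.1.trans ht.2)]
    exact Icc_subset_Icc_right ht.2
  set S : Set ℝ := {s ∈ Icc 0 t | τ s ≤ σ s} with hS
  have hSc : IsClosed S :=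
    isClosed_Icc.isClosed_le (hcont hm hτ) (hcont hn hσ)
  have hSK : IsCompact S := isCompact_Icc.of_isClosed_subset hSc fun s hs => hs.1
  have h0 : (0 : ℝ) ∈ S := by
    refine ⟨⟨le_rfl, ht.1⟩, ?_⟩
    rw [hτ 0 ⟨le_rfl, ht.1.trans ht.2⟩, hσ 0 ⟨le_rfl, ht.1.trans ht.2⟩]
    simp
  -- Let `s` be the last time before `t` with `τ ≤ σ`. After `s` one has `σ < τ`, hence `M(τ) ≤
  -- M(σ)`, and `τ` cannot have overtaken `σ`. No Lipschitz bound on `M` is needed.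
  obtain ⟨s, hs, hmax⟩ := hSK.exists_isGreatest ⟨0, h0⟩
  have hsT : s ∈ Icc 0 T := ⟨hs.1.1, hs.1.2.trans ht.2⟩
  have hgt : ∀ r ∈ Ioc s t, σ r < τ r := by
    intro r hr
    by_contra! h
    exact absurd (hmax ⟨⟨hs.1.1.trans hr.1.le, hr.2⟩, h⟩) (not_le.2 hr.1)
  have hsub : ∀ {m : ℝ → ℝ}, IntegrableOn m (Icc 0 T) → ∀ a ∈ Icc 0 T, ∀ b ∈ Icc 0 T,
      IntervalIntegrable m volume a b := by
    intro m hm a ha b hb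
    refine (hm.mono_set ?_).intervalIntegrable
    exact uIcc_subset_Icc ha hb
  have z0 : (0 : ℝ) ∈ Icc 0 T := ⟨le_rfl, ht.1.trans ht.2⟩
  have e1 : τ t = τ s + c * ∫ r in s..t, m r := by
    rw [hτ t ht, hτ s hsT, ← mul_add,
      intervalIntegral.integral_add_adjacent_intervals (hsub hm _ z0 _ hsT) (hsub hm _ hsT _ ht)]
  have e2 : σ t = σ s + c * ∫ r in s..t, n r := by
    rw [hσ t ht, hσ s hsT, ← mul_add,
      intervalIntegral.integral_add_adjacent_intervals (hsub hn _ z0 _ hsT) (hsub hn _ hsT _ ht)]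
  have e3 : ∫ r in s..t, m r ≤ ∫ r in s..t, n r := by
    rw [intervalIntegral.integral_of_le hs.1.2, intervalIntegral.integral_of_le hs.1.2]
    have hss : Ioc s t ⊆ Icc 0 T := fun r hr => ⟨hs.1.1.trans hr.1.le, hr.2.trans ht.2⟩
    refine setIntegral_mono_ae_restrict (hm.mono_set hss) (hn.mono_set hss) ?_
    filter_upwards [ae_restrict_of_ae_restrict_of_subset hss hmM,
      ae_restrict_of_ae_restrict_of_subset hss hnM, ae_restrict_mem measurableSet_Ioc]
      with r h1 h2 h3
    rw [h1, h2]
    exact hM (hgt r h3).le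
  have := mul_le_mul_of_nonneg_left e3 hc
  have := hs.2
  linarith

/-! ### The test functions `θ(t) sin(ξ x)`. -/

theorem spaceDeriv_mul_sin (k : ℕ) (a : ℝ → ℝ) (ξ t : ℝ) {x : ℝ} (hx : x ∈ Ici (0 : ℝ)) :
    spaceDeriv k (fun t x => a t * Real.sin (ξ * x)) t x
      = a t * (ξ ^ k * iteratedDeriv k Real.sin (ξ * x)) := by
  have hs : ContDiff ℝ k (fun x : ℝ => Real.sin (ξ * x)) := by fun_prop
  have h1 : ContDiff ℝ k (fun x : ℝ => a t * Real.sin (ξ * x)) := by fun_prop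
  unfold spaceDeriv
  rw [iteratedDerivWithin_eq_iteratedDeriv (uniqueDiffOn_Ici 0) h1.contDiffAt hx,
    iteratedDeriv_const_mul_field, iteratedDeriv_comp_const_mul Real.contDiff_sin]

theorem iteratedDeriv_two_sin (x : ℝ) : iteratedDeriv 2 Real.sin x = -Real.sin x := by
  simp [iteratedDeriv_succ, iteratedDeriv_zero]

theorem hasDerivAt_neg_integral_left {ψ : ℝ → ℝ} (hψ : Continuous ψ) (T t : ℝ) :
    HasDerivAt (fun t => -∫ s in t..T, ψ s) (ψ t) t := by
  have := (intervalIntegral.integral_hasDerivAt_left (hψ.intervalIntegrable t T)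
    (hψ.stronglyMeasurableAtFilter _ _) hψ.continuousAt).neg
  rw [neg_neg] at this
  exact this

theorem timeDeriv_mul_sin {T : ℝ} (hT : 0 < T) {ψ : ℝ → ℝ} (hψ : Continuous ψ) (ξ : ℝ) {t : ℝ}
    (ht : t ∈ Icc 0 T) :
    timeDeriv T (fun t x => (-∫ s in t..T, ψ s) * Real.sin (ξ * x)) t
      = fun x => ψ t * Real.sin (ξ * x) := by
  ext x
  exact ((hasDerivAt_neg_integral_left hψ T t).mul_const _).hasDerivWithinAt.derivWithin
    (uniqueDiffOn_Icc hT t ht)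

/-- The sine vanishes at `0` and is an eigenfunction of `∂ₓ²`, so the diffusion term becomes a
multiple of the sine transform. The time factor vanishes at `T` and has an arbitrary continuous
derivative `ψ`. -/
theorem isTestFunction_mul_sin {T : ℝ} (hT : 0 < T) {ψ : ℝ → ℝ} (hψ : Continuous ψ) (ξ : ℝ) :
    IsTestFunction T (fun t x => (-∫ s in t..T, ψ s) * Real.sin (ξ * x)) := by
  set θ : ℝ → ℝ := fun t => -∫ s in t..T, ψ s with hθ
  have hθd : ∀ t, HasDerivAt θ (ψ t) t := hasDerivAt_neg_integral_left hψ T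
  have hθc : Continuous θ := continuous_iff_continuousAt.2 fun t => (hθd t).continuousAt
  have htd : ∀ t ∈ Icc 0 T, timeDeriv T (fun t x => θ t * Real.sin (ξ * x)) t
      = fun x => ψ t * Real.sin (ξ * x) := fun t ht => timeDeriv_mul_sin hT hψ ξ ht
  have hcs : ∀ k : ℕ, Continuous (iteratedDeriv k Real.sin) := fun k =>
    (Real.contDiff_sin (n := k)).continuous_iteratedDeriv k le_rfl
  have hcont : ∀ (a : ℝ → ℝ), Continuous a → ∀ k : ℕ, ContinuousOn
      (fun p : ℝ × ℝ => spaceDeriv k (fun t x => a t * Real.sin (ξ * x)) p.1 p.2) (strip T) := by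
    intro a ha k
    have : Continuous fun p : ℝ × ℝ => a p.1 * (ξ ^ k * iteratedDeriv k Real.sin (ξ * p.2)) := by
      have := hcs k
      fun_prop
    exact this.continuousOn.congr fun p hp => spaceDeriv_mul_sin k a ξ p.1 hp.2
  obtain ⟨C₁, hC₁⟩ := isCompact_Icc.exists_bound_of_continuousOn (s := Icc 0 T) hθc.continuousOn
  obtain ⟨C₂, hC₂⟩ := isCompact_Icc.exists_bound_of_continuousOn (s := Icc 0 T) hψ.continuousOn
  have hC₁0 : 0 ≤ C₁ := (norm_nonneg _).trans (hC₁ 0 ⟨le_rfl, hT.le⟩)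
  have hC₂0 : 0 ≤ C₂ := (norm_nonneg _).trans (hC₂ 0 ⟨le_rfl, hT.le⟩)
  refine
    { contDiffOn_space := fun t _ => by fun_prop
      differentiableOn_time := fun x _ t _ =>
        ((hθd t).mul_const _).differentiableAt.differentiableWithinAt
      contDiffOn_timeDeriv := fun t ht => by
        rw [htd t ht]
        fun_prop
      continuousOn_spaceDeriv := fun k _ => hcont θ hθc k
      continuousOn_mixedDeriv := fun k _ => (hcont ψ hψ k).congr fun p hp => by
        simp only [spaceDeriv]
        rw [htd p.1 hp.1]
      bounded := ⟨C₁ + C₂ + C₁ * ξ ^ 2, fun t ht x hx => ⟨?_, ?_, ?_⟩⟩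
      terminal := fun x _ => by simp
      dirichlet := fun t _ => by simp }
  · have h1 := hC₁ t ht
    rw [Real.norm_eq_abs] at h1
    rw [abs_mul]
    have := mul_le_mul h1 (Real.abs_sin_le_one (ξ * x)) (abs_nonneg _) hC₁0
    have : 0 ≤ C₁ * ξ ^ 2 := by positivity
    linarith
  · have h1 := hC₂ t ht
    rw [Real.norm_eq_abs] at h1
    rw [htd t ht, abs_mul]
    have := mul_le_mul h1 (Real.abs_sin_le_one (ξ * x)) (abs_nonneg _) hC₂0
    have : 0 ≤ C₁ * ξ ^ 2 := by positivity
    linarith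
  · have h1 := hC₁ t ht
    rw [Real.norm_eq_abs] at h1
    change |spaceDeriv 2 (fun t x => θ t * Real.sin (ξ * x)) t x| ≤ _
    rw [spaceDeriv_mul_sin 2 θ ξ t hx, iteratedDeriv_two_sin, abs_mul, abs_mul,
      abs_neg (Real.sin _), abs_of_nonneg (sq_nonneg ξ)]
    have h2 := mul_le_mul_of_nonneg_left (Real.abs_sin_le_one (ξ * x)) (sq_nonneg ξ)
    have := mul_le_mul h1 h2 (by positivity) hC₁0
    linarith

theorem volume_restrict_strip (T : ℝ) : (volume : Measure (ℝ × ℝ)).restrict (strip T)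
    = (volume.restrict (Icc 0 T)).prod (volume.restrict (Ici (0 : ℝ))) := by
  rw [strip, Measure.volume_eq_prod, Measure.prod_restrict]

/-! ### Uniqueness: every non-negative solution is the time-changed heat flow. -/

section Uniqueness

variable {η T : ℝ} {fin : ℝ → ℝ} {f g : ℝ → ℝ → ℝ}

theorem IsVeryWeakSolution.integrable_prod (hf : IsVeryWeakSolution η T fin f) :
    Integrable (Function.uncurry f)
      ((volume.restrict (Icc 0 T)).prod (volume.restrict (Ici (0 : ℝ)))) := by
  rw [← volume_restrict_strip]
  exact hf.integrable

theorem IsVeryWeakSolution.integrableOn_mass (hf : IsVeryWeakSolution η T fin f) :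
    IntegrableOn (mass f) (Icc 0 T) :=
  hf.integrable_prod.integral_prod_left

/-- The sine transform of a very weak solution solves a linear ODE in time. -/
theorem IsVeryWeakSolution.sine_transform_eq (hT : 0 < T) (hf : IsVeryWeakSolution η T fin f)
    (ξ : ℝ) :
    ∀ᵐ t ∂(volume.restrict (Icc 0 T)), ∫ x in Ici (0 : ℝ), f t x * Real.sin (ξ * x)
      = (∫ x in Ici (0 : ℝ), fin x * Real.sin (ξ * x))
        * Real.exp (-(ξ ^ 2 * (η / 3 * ∫ s in (0 : ℝ)..t, mass f s))) := by
  set F : ℝ → ℝ := fun t => ∫ x in Ici (0 : ℝ), f t x * Real.sin (ξ * x) with hF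
  set c : ℝ := ∫ x in Ici (0 : ℝ), fin x * Real.sin (ξ * x) with hc
  set b : ℝ → ℝ := fun t => ξ ^ 2 * (η / 3) * mass f t with hb
  have hFint : IntegrableOn F (Icc 0 T) := by
    have : Integrable (fun p : ℝ × ℝ => Function.uncurry f p * Real.sin (ξ * p.2))
        ((volume.restrict (Icc 0 T)).prod (volume.restrict (Ici (0 : ℝ)))) :=
      hf.integrable_prod.mul_bdd (c := 1) (by fun_prop)
        (Eventually.of_forall fun p => Real.abs_sin_le_one _)
    exact this.integral_prod_left
  have hdiff : ∀ a : ℝ → ℝ, ∀ t, mass f t * ∫ x in Ici (0 : ℝ), f t x *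
      spaceDeriv 2 (fun t x => a t * Real.sin (ξ * x)) t x = -(ξ ^ 2 * mass f t * F t * a t) := by
    intro a t
    have : ∫ x in Ici (0 : ℝ), f t x * spaceDeriv 2 (fun t x => a t * Real.sin (ξ * x)) t x
        = ∫ x in Ici (0 : ℝ), (-(ξ ^ 2 * a t)) * (f t x * Real.sin (ξ * x)) := by
      refine setIntegral_congr_fun measurableSet_Ici fun x hx => ?_
      rw [spaceDeriv_mul_sin 2 a ξ t hx, iteratedDeriv_two_sin]
      ring
    rw [this, integral_const_mul, hF]
    ring
  -- Taking `ψ = 1` gives the time factor `-(T - t)`; this is the source of the weight.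
  have hH : IntegrableOn (fun t => (T - t) * (b t * F t)) (Icc 0 T) := by
    have h1 := hf.integrable_diffusion _
      (isTestFunction_mul_sin hT (continuous_const (y := (1 : ℝ))) ξ)
    refine (Integrable.const_mul h1 (η / 3)).congr (Eventually.of_forall fun t => ?_)
    simp only
    rw [hdiff]
    simp only [intervalIntegral.integral_const, smul_eq_mul, mul_one, hb]
    ring
  have hweak := ae_eq_sub_integral_of_weak (c := c) hT hFint hH (by
    intro ψ hψ
    have h1 := hf.weak_eq _ (isTestFunction_mul_sin hT hψ ξ)
    have e1 : ∫ t in Icc 0 T, ∫ x in Ici (0 : ℝ), f t x *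
        timeDeriv T (fun t x => (-∫ s in t..T, ψ s) * Real.sin (ξ * x)) t x
        = ∫ t in Icc 0 T, F t * ψ t := by
      refine setIntegral_congr_fun measurableSet_Icc fun t ht => ?_
      rw [timeDeriv_mul_sin hT hψ ξ ht, hF]
      simp only
      rw [← integral_mul_const]
      congr 1; ext x; ring
    have e2 : ∫ t in Icc 0 T, b t * F t * ∫ s in t..T, ψ s = η / 3 * ∫ t in Icc 0 T,
        mass f t * ∫ x in Ici (0 : ℝ), f t x *
          spaceDeriv 2 (fun t x => (-∫ s in t..T, ψ s) * Real.sin (ξ * x)) t x := by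
      rw [← integral_const_mul]
      congr 1; ext t
      rw [hdiff]
      simp only [hb]
      ring
    have e3 : ∫ x in Ici (0 : ℝ), fin x * ((-∫ s in (0 : ℝ)..T, ψ s) * Real.sin (ξ * x))
        = -(c * ∫ s in (0 : ℝ)..T, ψ s) := by
      rw [hc, ← integral_mul_const, ← integral_neg]
      congr 1; ext x; ring
    rw [e1, ← e2, e3] at h1
    linarith)
  -- The weight degenerates only at `T`. On `[0, t]` with `t < T` it is bounded below by `T - t` and
  -- can be divided out.
  have hneT : ∀ᵐ t ∂(volume.restrict (Icc 0 T)), t ≠ T := by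
    rw [ae_iff]; simp
  filter_upwards [hweak, ae_restrict_mem measurableSet_Icc, hneT] with t ht htI htT
  have hlt : t < T := lt_of_le_of_ne htI.2 htT
  have hsub : Icc 0 t ⊆ Icc 0 T := Icc_subset_Icc_right htI.2
  have hsub' : ∀ r ∈ Icc 0 t, uIoc 0 r ⊆ Icc 0 T := by
    intro r hr
    rw [uIoc_of_le hr.1]
    exact fun s hs => ⟨hs.1.le, hs.2.trans (hr.2.trans htI.2)⟩
  have hbF : IntegrableOn (fun s => b s * F s) (Icc 0 t) := by
    have h1 : IntegrableOn (fun s => (T - s)⁻¹ * ((T - s) * (b s * F s))) (Icc 0 t) := by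
      refine Integrable.bdd_mul (c := (T - t)⁻¹) (hH.mono_set hsub)
        (by fun_prop : Measurable fun s : ℝ => (T - s)⁻¹).aestronglyMeasurable ?_
      filter_upwards [ae_restrict_mem measurableSet_Icc] with s hs
      rw [Real.norm_of_nonneg (inv_nonneg.2 (by linarith [hs.2]))]
      exact inv_anti₀ (by linarith) (by linarith [hs.2])
    refine h1.congr_fun (fun s hs => ?_) measurableSet_Icc
    have : T - s ≠ 0 := by linarith [hs.2]
    field_simp
  -- `F` satisfies the integral equation only almost everywhere; its representative `G` satisfies it
  -- at every point.
  set G : ℝ → ℝ := fun r => c - ∫ s in (0 : ℝ)..r, b s * F s with hG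
  have hFG : ∀ᵐ s ∂(volume.restrict (Icc 0 T)), b s * F s = b s * G s := by
    filter_upwards [hweak] with s hs
    rw [hs]
  have h1 := eq_mul_exp_of_eq_sub_integral (b := b) (G := G) (c := c) (s := t)
    ((intervalIntegrable_iff_integrableOn_Icc_of_le htI.1).2
      (Integrable.const_mul (hf.integrableOn_mass.mono_set hsub) _))
    ((intervalIntegrable_iff_integrableOn_Icc_of_le htI.1).2
      (hbF.congr_fun_ae (ae_restrict_of_ae_restrict_of_subset hsub hFG)))
    (by
      intro r hr
      rw [uIcc_of_le htI.1] at hr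
      simp only [hG]
      congr 1
      refine intervalIntegral.integral_congr_ae ?_
      have := ae_restrict_of_ae_restrict_of_subset (hsub' r hr) hFG
      exact (ae_restrict_iff' measurableSet_uIoc).1 this)
  refine ht.trans (h1.trans ?_)
  simp only [hb, intervalIntegral.integral_const_mul]
  ring_nf

theorem continuous_sine_transform {h : ℝ → ℝ} (hh : IntegrableOn h (Ici 0)) :
    Continuous fun ξ : ℝ => ∫ x in Ici (0 : ℝ), h x * Real.sin (ξ * x) := by
  refine continuous_of_dominated (bound := fun x => ‖h x‖) ?_ ?_ hh.norm ?_
  · intro ξ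
    exact hh.aestronglyMeasurable.mul (by fun_prop)
  · intro ξ
    refine Eventually.of_forall fun x => ?_
    rw [norm_mul]
    exact mul_le_of_le_one_right (norm_nonneg _) (Real.abs_sin_le_one _)
  · exact Eventually.of_forall fun x => by fun_prop

/-- The exceptional null set of times depends on `ξ`. Countably many rational `ξ` share one null
set, and continuity in `ξ` extends the identity to all real `ξ`. -/
theorem IsVeryWeakSolution.ae_sine_transform_eq (hT : 0 < T) (hfin : IntegrableOn fin (Ici 0))
    (hf : IsVeryWeakSolution η T fin f) :
    ∀ᵐ t ∂(volume.restrict (Icc 0 T)), ∀ ξ : ℝ, ∫ x in Ici (0 : ℝ), f t x * Real.sin (ξ * x)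
      = (∫ x in Ici (0 : ℝ), fin x * Real.sin (ξ * x))
        * Real.exp (-(ξ ^ 2 * (η / 3 * ∫ s in (0 : ℝ)..t, mass f s))) := by
  have h1 : ∀ᵐ t ∂(volume.restrict (Icc 0 T)), ∀ q : ℚ, _ :=
    ae_all_iff.2 fun q : ℚ => hf.sine_transform_eq hT (q : ℝ)
  filter_upwards [h1, hf.integrable_prod.prod_right_ae] with t ht hti
  have hc1 := continuous_sine_transform (h := f t) hti
  have hc2 := continuous_sine_transform hfin
  exact congrFun (Continuous.ext_on Rat.denseRange_cast hc1
    (hc2.mul (by fun_prop)) (by rintro _ ⟨q, rfl⟩; exact ht q))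

/-- A family `u τ` of nonnegative integrable functions whose sine transforms are those of the heat
flow started from `fin`, with nonincreasing mass. -/
structure IsHeatFlow (fin : ℝ → ℝ) (u : ℝ → ℝ → ℝ) : Prop where
  integrable : ∀ τ, IntegrableOn (u τ) (Ici 0)
  nonneg : ∀ τ, ∀ᵐ x ∂(volume.restrict (Ici (0 : ℝ))), 0 ≤ u τ x
  sine_transform : ∀ τ, 0 ≤ τ → ∀ ξ : ℝ, ∫ x in Ici (0 : ℝ), u τ x * Real.sin (ξ * x)
    = (∫ x in Ici (0 : ℝ), fin x * Real.sin (ξ * x)) * Real.exp (-(ξ ^ 2 * τ))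
  antitone_mass : Antitone (mass u)

theorem IsVeryWeakSolution.ae_eq_heatFlow (hη : 0 < η) (hT : 0 < T)
    (hfin : IntegrableOn fin (Ici 0)) {u : ℝ → ℝ → ℝ} (hu : IsHeatFlow fin u)
    (hf : IsVeryWeakSolution η T fin f) (hf0 : IsNonnegative T f) :
    ∀ᵐ t ∂(volume.restrict (Icc 0 T)), ∀ᵐ x ∂(volume.restrict (Ici (0 : ℝ))),
      f t x = u (η / 3 * ∫ s in (0 : ℝ)..t, mass f s) x := by
  have h0 : ∀ᵐ t ∂(volume.restrict (Icc 0 T)), ∀ᵐ x ∂(volume.restrict (Ici (0 : ℝ))),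
      0 ≤ f t x := by
    have := hf0
    rw [IsNonnegative, volume_restrict_strip] at this
    exact Measure.ae_ae_of_ae_prod this
  have hm0 : ∀ᵐ t ∂(volume.restrict (Icc 0 T)), 0 ≤ mass f t := by
    filter_upwards [h0] with t ht
    exact integral_nonneg_of_ae ht
  filter_upwards [h0, hf.ae_sine_transform_eq hT hfin, hf.integrable_prod.prod_right_ae,
    ae_restrict_mem measurableSet_Icc] with t ht hs hi htI
  have hτ : 0 ≤ η / 3 * ∫ s in (0 : ℝ)..t, mass f s := by
    refine mul_nonneg (by positivity) ?_
    refine intervalIntegral.integral_nonneg_of_ae_restrict htI.1 ?_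
    exact ae_restrict_of_ae_restrict_of_subset (Icc_subset_Icc_right htI.2) hm0
  refine ae_eq_of_sine_transform_eq hi (hu.integrable _) ht (hu.nonneg _) fun ξ => ?_
  rw [hs ξ, hu.sine_transform _ hτ]

/-- Both solutions are the same heat flow read on their own clocks, and integrating in `x` shows
that both clocks solve the same equation with nonincreasing `M`. Comparison in each direction
identifies them. -/
theorem IsVeryWeakSolution.ae_eq (hη : 0 < η) (hT : 0 < T)
    (hfin : IntegrableOn fin (Ici 0)) {u : ℝ → ℝ → ℝ} (hu : IsHeatFlow fin u)
    (hf : IsVeryWeakSolution η T fin f) (hf0 : IsNonnegative T f)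
    (hg : IsVeryWeakSolution η T fin g) (hg0 : IsNonnegative T g) :
    ∀ᵐ p : ℝ × ℝ ∂(volume.restrict (strip T)), g p.1 p.2 = f p.1 p.2 := by
  have hfu := hf.ae_eq_heatFlow hη hT hfin hu hf0
  have hgu := hg.ae_eq_heatFlow hη hT hfin hu hg0
  have hM : ∀ {h : ℝ → ℝ → ℝ}, (∀ᵐ t ∂(volume.restrict (Icc 0 T)),
      ∀ᵐ x ∂(volume.restrict (Ici (0 : ℝ))), h t x = u (η / 3 * ∫ s in (0 : ℝ)..t, mass h s) x) →
      ∀ᵐ t ∂(volume.restrict (Icc 0 T)),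
        mass h t = mass u (η / 3 * ∫ s in (0 : ℝ)..t, mass h s) := by
    intro h hh
    filter_upwards [hh] with t ht
    exact integral_congr_ae ht
  have hc : 0 ≤ η / 3 := by positivity
  have hτ : ∀ t ∈ Icc 0 T, η / 3 * ∫ s in (0 : ℝ)..t, mass f s
      = η / 3 * ∫ s in (0 : ℝ)..t, mass g s := by
    intro t ht
    exact le_antisymm
      (le_of_integral_antitone hc hu.antitone_mass hf.integrableOn_mass hg.integrableOn_mass
        (fun _ _ => rfl) (fun _ _ => rfl) (hM hfu) (hM hgu) t ht)
      (le_of_integral_antitone hc hu.antitone_mass hg.integrableOn_mass hf.integrableOn_mass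
        (fun _ _ => rfl) (fun _ _ => rfl) (hM hgu) (hM hfu) t ht)
  rw [volume_restrict_strip]
  -- Equality on almost every slice passes to the strip through `∫ |g - f| = 0`.
  have hd := (hg.integrable_prod.sub hf.integrable_prod).norm
  have hz : ∫ p, ‖(Function.uncurry g - Function.uncurry f) p‖
      ∂((volume.restrict (Icc 0 T)).prod (volume.restrict (Ici (0 : ℝ)))) = 0 := by
    rw [integral_prod _ hd]
    refine integral_eq_zero_of_ae ?_
    filter_upwards [hfu, hgu, ae_restrict_mem measurableSet_Icc] with t h1 h2 h3
    refine integral_eq_zero_of_ae ?_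
    filter_upwards [h1, h2] with x h4 h5
    simp only [Pi.sub_apply, Function.uncurry_apply_pair, Pi.zero_apply, norm_eq_zero]
    rw [h4, h5, hτ t h3, sub_self]
  have := (integral_eq_zero_iff_of_nonneg (fun _ => norm_nonneg _) hd).1 hz
  filter_upwards [this] with p hp
  simpa [sub_eq_zero, Function.uncurry] using hp

end Uniqueness

/-! ### The Dirichlet heat flow by the method of images. -/

/-- The heat kernel on the real line. -/
def heatKernel (τ z : ℝ) : ℝ := (√(4 * Real.pi * τ))⁻¹ * Real.exp (-z ^ 2 / (4 * τ))

/-- The Dirichlet heat kernel on the half-line. -/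
def dirichletKernel (τ x y : ℝ) : ℝ := heatKernel τ (x - y) - heatKernel τ (x + y)

/-- The extension of a function by zero to the negative half-line, made odd. -/
def oddExt (F : ℝ → ℝ) (x : ℝ) : ℝ := (Ici 0).indicator F x - (Ici 0).indicator F (-x)

/-- The solution of the heat equation on the half-line with Dirichlet condition. -/
def heatSol (fin : ℝ → ℝ) (τ x : ℝ) : ℝ :=
  if 0 < τ then ∫ y in Ici (0 : ℝ), dirichletKernel τ x y * fin y else fin x

theorem measurable_heatKernel : Measurable (Function.uncurry heatKernel) := by
  unfold heatKernel Function.uncurry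
  fun_prop

theorem heatKernel_nonneg (τ z : ℝ) : 0 ≤ heatKernel τ z := by
  unfold heatKernel; positivity

theorem heatKernel_sub_eq_gaussianPDFReal {τ : ℝ} (hτ : 0 < τ) (x y : ℝ) :
    heatKernel τ (x - y) = gaussianPDFReal y (2 * τ).toNNReal x := by
  rw [gaussianPDFReal, heatKernel, Real.coe_toNNReal _ (by positivity)]
  ring_nf

theorem integrable_heatKernel_sub {τ : ℝ} (hτ : 0 < τ) (y : ℝ) :
    Integrable (fun x => heatKernel τ (x - y)) := by
  simp_rw [heatKernel_sub_eq_gaussianPDFReal hτ]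
  exact integrable_gaussianPDFReal _ _

/-- The kernel is the density of `y + √(2τ) Z` with `Z` standard normal. Moving `τ` into the
argument of `F` leaves a fixed measure, so limits in `τ` become dominated convergence. -/
theorem integral_heatKernel_mul {τ : ℝ} (hτ : 0 < τ) (y : ℝ) {F : ℝ → ℝ} (hF : Measurable F) :
    ∫ x, heatKernel τ (x - y) * F x = ∫ z, F (y + √(2 * τ) * z) ∂(gaussianReal 0 1) := by
  have hv : (2 * τ).toNNReal ≠ 0 := by
    simpa using hτ
  simp_rw [heatKernel_sub_eq_gaussianPDFReal hτ]
  have h1 : (gaussianReal 0 1).map (fun z => y + √(2 * τ) * z)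
      = gaussianReal y (2 * τ).toNNReal := by
    have : (fun z => y + √(2 * τ) * z) = (fun z => y + z) ∘ fun z => √(2 * τ) * z := rfl
    rw [this, ← Measure.map_map (by fun_prop) (by fun_prop), gaussianReal_map_const_mul,
      gaussianReal_map_const_add]
    congr 1
    · simp
    · ext
      simp [mul_pow, hτ.le]
  have h2 := integral_gaussianReal_eq_integral_smul (μ := y) hv (f := F)
  simp only [smul_eq_mul] at h2
  rw [← h2, ← h1, integral_map (by fun_prop) hF.aestronglyMeasurable]

theorem dirichletKernel_nonneg {τ x y : ℝ} (hτ : 0 < τ) (hx : 0 ≤ x) (hy : 0 ≤ y) :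
    0 ≤ dirichletKernel τ x y := by
  unfold dirichletKernel heatKernel
  rw [← mul_sub]
  refine mul_nonneg (by positivity) (sub_nonneg.2 (Real.exp_le_exp.2 ?_))
  refine div_le_div_of_nonneg_right ?_ (by positivity)
  nlinarith [mul_nonneg hx hy]

theorem abs_dirichletKernel_le {τ x y : ℝ} (hτ : 0 < τ) (hx : 0 ≤ x) (hy : 0 ≤ y) :
    |dirichletKernel τ x y| ≤ heatKernel τ (x - y) := by
  rw [abs_of_nonneg (dirichletKernel_nonneg hτ hx hy)]
  exact sub_le_self _ (heatKernel_nonneg _ _)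

theorem measurable_dirichletKernel :
    Measurable fun p : ℝ × ℝ × ℝ => dirichletKernel p.1 p.2.1 p.2.2 := by
  unfold dirichletKernel
  exact (measurable_heatKernel.comp (by fun_prop : Measurable fun p : ℝ × ℝ × ℝ =>
    (p.1, p.2.1 - p.2.2))).sub (measurable_heatKernel.comp
      (by fun_prop : Measurable fun p : ℝ × ℝ × ℝ => (p.1, p.2.1 + p.2.2)))

theorem measurable_oddExt {F : ℝ → ℝ} (hF : Measurable F) : Measurable (oddExt F) :=
  (hF.indicator measurableSet_Ici).sub ((hF.indicator measurableSet_Ici).comp measurable_neg)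

theorem abs_oddExt_le {F : ℝ → ℝ} {C : ℝ} (hC : ∀ x, 0 ≤ x → |F x| ≤ C) (x : ℝ) :
    |oddExt F x| ≤ 2 * C := by
  have h : ∀ x, |(Ici 0).indicator F x| ≤ C := by
    intro x
    by_cases hx : x ∈ Ici (0 : ℝ)
    · rw [indicator_of_mem hx]; exact hC x hx
    · rw [indicator_of_notMem hx, abs_zero]; exact (abs_nonneg _).trans (hC 0 le_rfl)
  have h3 := abs_sub ((Ici 0).indicator F x) ((Ici 0).indicator F (-x))
  unfold oddExt
  linarith [h x, h (-x)]

theorem integral_gaussian_comp_neg (F : ℝ → ℝ) :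
    ∫ z, F (-z) ∂(gaussianReal 0 1) = ∫ z, F z ∂(gaussianReal 0 1) := by
  have h : (gaussianReal 0 1).map (fun z => -z) = gaussianReal 0 1 := by
    rw [gaussianReal_map_neg, neg_zero]
  conv_rhs => rw [← h]
  exact (MeasurableEquiv.neg ℝ).measurableEmbedding.integral_map F |>.symm

/-- Method of images: by the symmetry of the Gaussian, the image source at `-y` acting on `F` equals
the source at `y` acting on the reflection of `F`. -/
theorem integral_dirichletKernel_mul {τ : ℝ} (hτ : 0 < τ) (y : ℝ) {F : ℝ → ℝ}
    (hF : Measurable F) {C : ℝ} (hC : ∀ x, 0 ≤ x → |F x| ≤ C) :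
    ∫ x in Ici (0 : ℝ), dirichletKernel τ x y * F x
      = ∫ z, oddExt F (y + √(2 * τ) * z) ∂(gaussianReal 0 1) := by
  set E : ℝ → ℝ := (Ici 0).indicator F with hE
  have hEm : Measurable E := hF.indicator measurableSet_Ici
  have hEC : ∀ x, ‖E x‖ ≤ C := by
    intro x
    by_cases hx : x ∈ Ici (0 : ℝ)
    · rw [hE, indicator_of_mem hx]; exact hC x hx
    · rw [hE, indicator_of_notMem hx, norm_zero]; exact (abs_nonneg _).trans (hC 0 le_rfl)
  have hi : ∀ y, Integrable fun x => heatKernel τ (x - y) * E x := fun y =>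
    (integrable_heatKernel_sub hτ y).mul_bdd (c := C) hEm.aestronglyMeasurable
      (Eventually.of_forall hEC)
  have hg : ∀ g : ℝ → ℝ, Measurable g → Integrable (fun z => E (g z)) (gaussianReal 0 1) :=
    fun g hg => Integrable.of_bound (hEm.comp hg).aestronglyMeasurable C
      (Eventually.of_forall fun z => hEC _)
  calc ∫ x in Ici (0 : ℝ), dirichletKernel τ x y * F x
      = ∫ x, (heatKernel τ (x - y) * E x - heatKernel τ (x - (-y)) * E x) := by
        rw [← integral_indicator measurableSet_Ici]
        congr 1; ext x
        by_cases hx : x ∈ Ici (0 : ℝ)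
        · simp only [hE, indicator_of_mem hx, dirichletKernel, sub_neg_eq_add]; ring
        · simp only [hE, indicator_of_notMem hx]; ring
    _ = (∫ z, E (y + √(2 * τ) * z) ∂(gaussianReal 0 1))
        - ∫ z, E (-y + √(2 * τ) * z) ∂(gaussianReal 0 1) := by
        rw [integral_sub (hi y) (hi (-y)), integral_heatKernel_mul hτ y hEm,
          integral_heatKernel_mul hτ (-y) hEm]
    _ = (∫ z, E (y + √(2 * τ) * z) ∂(gaussianReal 0 1))
        - ∫ z, E (-(y + √(2 * τ) * z)) ∂(gaussianReal 0 1) := by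
        rw [← integral_gaussian_comp_neg fun z => E (-y + √(2 * τ) * z)]
        congr 3; ext z; ring_nf
    _ = _ := by
        rw [← integral_sub (hg _ (by fun_prop)) (hg _ (by fun_prop))]
        rfl

section HeatSolution

variable {fin : ℝ → ℝ}

theorem integrable_prod_dirichletKernel {τ : ℝ} (hτ : 0 < τ) (hfin : IntegrableOn fin (Ici 0)) :
    Integrable (fun p : ℝ × ℝ => dirichletKernel τ p.1 p.2 * fin p.2)
      ((volume.restrict (Ici (0 : ℝ))).prod (volume.restrict (Ici (0 : ℝ)))) := by
  have h1 : Integrable (fun p : ℝ × ℝ => fin p.2 * heatKernel τ (p.1 - p.2))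
      (volume.prod (volume.restrict (Ici (0 : ℝ)))) := by
    have hk : Integrable (fun x => heatKernel τ x) := by
      simpa using integrable_heatKernel_sub hτ 0
    exact Integrable.convolution_integrand (ContinuousLinearMap.mul ℝ ℝ) hfin hk
  have h2 : Integrable (fun p : ℝ × ℝ => fin p.2 * heatKernel τ (p.1 - p.2))
      ((volume.restrict (Ici (0 : ℝ))).prod (volume.restrict (Ici (0 : ℝ)))) :=
    h1.mono_measure (Measure.prod_mono Measure.restrict_le_self le_rfl)
  refine h2.norm.mono' ?_ ?_
  · exact (measurable_dirichletKernel.comp (by fun_prop : Measurable fun p : ℝ × ℝ =>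
      (τ, p.1, p.2))).aestronglyMeasurable.mul hfin.aestronglyMeasurable.comp_snd
  · rw [Measure.prod_restrict]
    filter_upwards [ae_restrict_mem (measurableSet_Ici.prod measurableSet_Ici)] with p hp
    rw [norm_mul, norm_mul, mul_comm, Real.norm_eq_abs (dirichletKernel _ _ _),
      Real.norm_of_nonneg (heatKernel_nonneg _ _)]
    exact mul_le_mul_of_nonneg_left (abs_dirichletKernel_le hτ hp.1 hp.2) (norm_nonneg _)

theorem integrableOn_heatSol (hfin : IntegrableOn fin (Ici 0)) (τ : ℝ) :
    IntegrableOn (heatSol fin τ) (Ici 0) := by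
  by_cases hτ : 0 < τ
  · refine (integrable_prod_dirichletKernel hτ hfin).integral_prod_left.congr
      (Eventually.of_forall fun x => ?_)
    simp only [heatSol, if_pos hτ]
  · refine hfin.congr (Eventually.of_forall fun x => ?_)
    simp only [heatSol, if_neg hτ]

theorem heatSol_nonneg (hfin0 : ∀ᵐ x ∂(volume.restrict (Ici (0 : ℝ))), 0 ≤ fin x) (τ : ℝ) :
    ∀ᵐ x ∂(volume.restrict (Ici (0 : ℝ))), 0 ≤ heatSol fin τ x := by
  by_cases hτ : 0 < τ
  · filter_upwards [ae_restrict_mem measurableSet_Ici] with x hx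
    simp only [heatSol, if_pos hτ]
    refine integral_nonneg_of_ae ?_
    filter_upwards [hfin0, ae_restrict_mem measurableSet_Ici] with y h1 h2
    exact mul_nonneg (dirichletKernel_nonneg hτ hx h2) h1
  · filter_upwards [hfin0] with x hx
    simpa only [heatSol, if_neg hτ] using hx

theorem integral_heatSol_mul {τ : ℝ} (hτ : 0 < τ) (hfin : IntegrableOn fin (Ici 0)) {F : ℝ → ℝ}
    (hF : AEStronglyMeasurable F (volume.restrict (Ici (0 : ℝ)))) {C : ℝ}
    (hC : ∀ x, 0 ≤ x → |F x| ≤ C) :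
    ∫ x in Ici (0 : ℝ), heatSol fin τ x * F x
      = ∫ y in Ici (0 : ℝ), fin y * ∫ x in Ici (0 : ℝ), dirichletKernel τ x y * F x := by
  have hi : Integrable (Function.uncurry fun x y => dirichletKernel τ x y * fin y * F x)
      ((volume.restrict (Ici (0 : ℝ))).prod (volume.restrict (Ici (0 : ℝ)))) := by
    refine (integrable_prod_dirichletKernel hτ hfin).mul_bdd (c := C) hF.comp_fst ?_
    rw [Measure.prod_restrict]
    filter_upwards [ae_restrict_mem (measurableSet_Ici.prod measurableSet_Ici)] with p hp
    exact hC p.1 hp.1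
  calc ∫ x in Ici (0 : ℝ), heatSol fin τ x * F x
      = ∫ x in Ici (0 : ℝ), ∫ y in Ici (0 : ℝ), dirichletKernel τ x y * fin y * F x := by
        congr 1; ext x
        simp only [heatSol, if_pos hτ]
        rw [integral_mul_const]
    _ = ∫ y in Ici (0 : ℝ), ∫ x in Ici (0 : ℝ), dirichletKernel τ x y * fin y * F x :=
        integral_integral_swap hi
    _ = _ := by
        congr 1; ext y
        rw [← integral_const_mul]
        congr 1; ext x; ring

theorem oddExt_sin (ξ x : ℝ) : oddExt (fun x => Real.sin (ξ * x)) x = Real.sin (ξ * x) := by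
  unfold oddExt
  rcases lt_trichotomy x 0 with h | h | h
  · rw [indicator_of_notMem (by simpa using h), indicator_of_mem (by simpa using h.le)]
    simp
  · subst h; simp
  · rw [indicator_of_mem (by simpa using h.le), indicator_of_notMem (by simpa using h), sub_zero]

/-- Imaginary part of the Gaussian characteristic function, shifted by `y`. With `s = √(2τ)` the
factor is `exp(-ξ² τ)`. -/
theorem integral_gaussian_sin (ξ y s : ℝ) :
    ∫ z, Real.sin (ξ * (y + s * z)) ∂(gaussianReal 0 1)
      = Real.sin (ξ * y) * Real.exp (-(ξ ^ 2 * s ^ 2 / 2)) := by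
  have h1 := charFun_gaussianReal (μ := 0) (v := 1) (ξ * s)
  rw [charFun_apply_real] at h1
  have hI : Integrable (fun z : ℝ => Complex.exp (((ξ * (y + s * z) : ℝ) : ℂ) * Complex.I))
      (gaussianReal 0 1) :=
    Integrable.of_bound (by fun_prop) 1 (Eventually.of_forall fun z => by
      rw [Complex.norm_exp_ofReal_mul_I])
  have h2 : ∫ z : ℝ, Complex.exp (((ξ * (y + s * z) : ℝ) : ℂ) * Complex.I) ∂(gaussianReal 0 1)
      = Complex.exp (((ξ * y : ℝ) : ℂ) * Complex.I)
        * ((Real.exp (-(ξ ^ 2 * s ^ 2 / 2)) : ℝ) : ℂ) := by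
    have : ∀ z : ℝ, Complex.exp (((ξ * (y + s * z) : ℝ) : ℂ) * Complex.I)
        = Complex.exp (((ξ * y : ℝ) : ℂ) * Complex.I)
          * Complex.exp (((ξ * s : ℝ) : ℂ) * (z : ℂ) * Complex.I) := by
      intro z
      rw [← Complex.exp_add]
      congr 1; push_cast; ring
    simp_rw [this]
    rw [integral_const_mul, h1]
    congr 1
    push_cast
    congr 1
    ring
  have h3 := congrArg Complex.im h2
  rw [Complex.im_mul_ofReal, Complex.exp_ofReal_mul_I_im] at h3
  rw [← h3]
  have h4 := integral_im hI
  simp only [RCLike.im_to_complex, Complex.exp_ofReal_mul_I_im] at h4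
  exact h4

theorem sine_transform_heatSol (hfin : IntegrableOn fin (Ici 0)) {τ : ℝ} (hτ : 0 ≤ τ) (ξ : ℝ) :
    ∫ x in Ici (0 : ℝ), heatSol fin τ x * Real.sin (ξ * x)
      = (∫ x in Ici (0 : ℝ), fin x * Real.sin (ξ * x)) * Real.exp (-(ξ ^ 2 * τ)) := by
  rcases hτ.eq_or_lt with rfl | hτ
  · simp [heatSol]
  · have hC : ∀ x, 0 ≤ x → |Real.sin (ξ * x)| ≤ 1 := fun x _ => Real.abs_sin_le_one _
    rw [integral_heatSol_mul hτ hfin (by fun_prop) hC, ← integral_mul_const]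
    congr 1; ext y
    rw [integral_dirichletKernel_mul hτ y (by fun_prop) hC]
    simp_rw [oddExt_sin]
    rw [integral_gaussian_sin, Real.sq_sqrt (by positivity)]
    ring_nf

/-! ### The mass of the heat flow. -/

theorem setIntegral_Ioi_antitone (hfin : IntegrableOn fin (Ici 0))
    (hfin0 : ∀ᵐ x ∂(volume.restrict (Ici (0 : ℝ))), 0 ≤ fin x) {r s : ℝ} (hr : 0 ≤ r)
    (hrs : r ≤ s) : ∫ y in Ioi s, fin y ≤ ∫ y in Ioi r, fin y := by
  have hsub : Ioi r ⊆ Ici (0 : ℝ) := fun y hy => hr.trans (mem_Ioi.1 hy).le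
  exact setIntegral_mono_set (hfin.mono_set hsub)
    (ae_restrict_of_ae_restrict_of_subset hsub hfin0) (Ioi_subset_Ioi hrs).eventuallyLE

theorem setIntegral_Ioi_mem (hfin : IntegrableOn fin (Ici 0))
    (hfin0 : ∀ᵐ x ∂(volume.restrict (Ici (0 : ℝ))), 0 ≤ fin x) {r : ℝ} (hr : 0 ≤ r) :
    0 ≤ ∫ y in Ioi r, fin y ∧ ∫ y in Ioi r, fin y ≤ ∫ y in Ioi 0, fin y := by
  refine ⟨integral_nonneg_of_ae (ae_restrict_of_ae_restrict_of_subset ?_ hfin0),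
    setIntegral_Ioi_antitone hfin hfin0 le_rfl hr⟩
  exact fun y hy => hr.trans (mem_Ioi.1 hy).le

theorem continuous_setIntegral_Ioi_abs (hfin : IntegrableOn fin (Ici 0)) :
    Continuous fun w : ℝ => ∫ y in Ioi |w|, fin y := by
  have h0 : IntegrableOn fin (Ioi 0) := hfin.mono_set Ioi_subset_Ici_self
  have h1 : ∀ w : ℝ, ∫ y in Ioi |w|, fin y
      = (∫ y in Ioi 0, fin y) - ∫ y in (0 : ℝ)..|w|, (Ioi 0).indicator fin y := by
    intro w
    have e1 := intervalIntegral.integral_of_le (f := (Ioi 0).indicator fin) (μ := volume)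
      (abs_nonneg w)
    have e2 : ∫ y in Ioc 0 |w|, (Ioi 0).indicator fin y = ∫ y in Ioc 0 |w|, fin y :=
      setIntegral_congr_fun measurableSet_Ioc fun y hy => indicator_of_mem (mem_Ioi.2 hy.1) _
    have e3 : ∫ y in Ioi 0, fin y = (∫ y in Ioc 0 |w|, fin y) + ∫ y in Ioi |w|, fin y := by
      rw [← setIntegral_union (Ioc_disjoint_Ioi le_rfl) measurableSet_Ioi
        (h0.mono_set Ioc_subset_Ioi_self) (h0.mono_set (Ioi_subset_Ioi (abs_nonneg w))),
        Ioc_union_Ioi_eq_Ioi (abs_nonneg w)]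
    rw [e1, e2, e3]; ring
  simp_rw [h1]
  have hI : Integrable ((Ioi 0).indicator fin) := (integrable_indicator_iff measurableSet_Ioi).2 h0
  exact continuous_const.sub ((intervalIntegral.continuous_primitive
    (fun a b => hI.intervalIntegrable) 0).comp continuous_abs)

/-- The odd extension of `1` is the sign function, and for `y > 0`, `y ≠ |w|`, the sum `sign(y + w)
+ sign(y - w)` is `2` if `y > |w|` and `0` otherwise. -/
theorem integral_mul_oddExt_one_symm (hfin : IntegrableOn fin (Ici 0)) (w : ℝ) :
    (∫ y in Ici (0 : ℝ), fin y * oddExt (fun _ => 1) (y + w))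
      + ∫ y in Ici (0 : ℝ), fin y * oddExt (fun _ => 1) (y + -w) = 2 * ∫ y in Ioi |w|, fin y := by
  have hm := measurable_oddExt (F := fun _ => (1 : ℝ)) measurable_const
  have hi : ∀ v : ℝ, IntegrableOn (fun y => fin y * oddExt (fun _ => 1) (y + v)) (Ici 0) := by
    intro v
    refine hfin.mul_bdd (c := 2 * 1) (hm.comp (by fun_prop)).aestronglyMeasurable
      (Eventually.of_forall fun y => ?_)
    exact abs_oddExt_le (fun x _ => by simp) _
  rw [← integral_add (hi w) (hi (-w)), ← integral_const_mul,
    ← integral_indicator measurableSet_Ici, ← integral_indicator measurableSet_Ioi]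
  refine integral_congr_ae ?_
  have hne : ∀ a : ℝ, ∀ᵐ y : ℝ, y ≠ a := fun a => by rw [ae_iff]; simp
  filter_upwards [hne |w|, hne 0] with y hy hy0
  by_cases h0 : y ∈ Ici (0 : ℝ)
  · rw [indicator_of_mem h0]
    have h0' : 0 < y := lt_of_le_of_ne h0 (Ne.symm hy0)
    by_cases h1 : |w| < y
    · rw [indicator_of_mem (mem_Ioi.2 h1)]
      rw [abs_lt] at h1
      unfold oddExt
      rw [indicator_of_mem (by simp; linarith), indicator_of_notMem (by simp; linarith),
        indicator_of_mem (by simp; linarith), indicator_of_notMem (by simp; linarith)]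
      ring
    · rw [indicator_of_notMem (by simpa using h1)]
      have h2 : y < |w| := lt_of_le_of_ne (not_lt.1 h1) hy
      unfold oddExt
      rcases lt_abs.1 h2 with h | h
      · rw [indicator_of_mem (by simp; linarith), indicator_of_notMem (by simp; linarith),
          indicator_of_notMem (by simp; linarith), indicator_of_mem (by simp; linarith)]
        ring
      · rw [indicator_of_notMem (by simp; linarith), indicator_of_mem (by simp; linarith),
          indicator_of_mem (by simp; linarith), indicator_of_notMem (by simp; linarith)]
        ring
  · rw [indicator_of_notMem h0, indicator_of_notMem]
    intro h
    exact h0 ((abs_nonneg w).trans (mem_Ioi.1 h).le)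

/-- The mass of the heat solution as a Gaussian average of tails of the initial datum. -/
theorem mass_heatSol (hfin : IntegrableOn fin (Ici 0)) (τ : ℝ) :
    mass (heatSol fin) τ = ∫ z, (∫ y in Ioi |√(2 * τ) * z|, fin y) ∂(gaussianReal 0 1) := by
  by_cases hτ : 0 < τ
  · have hC : ∀ x : ℝ, 0 ≤ x → |(1 : ℝ)| ≤ 1 := fun x _ => by simp
    have h1 := integral_heatSol_mul hτ hfin (F := fun _ => 1) (by fun_prop) hC
    simp_rw [integral_dirichletKernel_mul hτ _ (F := fun _ => 1) measurable_const hC,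
      mul_one] at h1
    set A : ℝ → ℝ := fun w => ∫ y in Ici (0 : ℝ), fin y * oddExt (fun _ => 1) (y + w) with hA
    have hm := measurable_oddExt (F := fun _ => (1 : ℝ)) measurable_const
    have hi : Integrable (Function.uncurry fun y z =>
        fin y * oddExt (fun _ => 1) (y + √(2 * τ) * z))
        ((volume.restrict (Ici (0 : ℝ))).prod (gaussianReal 0 1)) := by
      refine (hfin.comp_fst _).mul_bdd (c := 2 * 1) (hm.comp (by fun_prop)).aestronglyMeasurable
        (Eventually.of_forall fun y => ?_)
      exact abs_oddExt_le (fun x _ => by simp) _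
    have h2 : mass (heatSol fin) τ = ∫ z, A (√(2 * τ) * z) ∂(gaussianReal 0 1) := by
      rw [mass, h1]
      simp_rw [← integral_const_mul]
      exact integral_integral_swap hi
    have hAi : Integrable (fun z => A (√(2 * τ) * z)) (gaussianReal 0 1) := hi.integral_prod_right
    have hAi' : Integrable (fun z => A (-(√(2 * τ) * z))) (gaussianReal 0 1) := by
      have h := gaussianReal_map_neg (μ := 0) (v := 1)
      rw [neg_zero] at h
      rw [← h] at hAi
      have := hAi.comp_measurable measurable_neg
      refine this.congr (Eventually.of_forall fun z => ?_)
      simp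
    have h3 : ∫ z, A (√(2 * τ) * z) ∂(gaussianReal 0 1)
        = ∫ z, A (-(√(2 * τ) * z)) ∂(gaussianReal 0 1) := by
      rw [← integral_gaussian_comp_neg]
      simp_rw [mul_neg]
    -- The Gaussian is even, so `A` may be averaged over `w` and `-w`.
    have h4 : 2 * mass (heatSol fin) τ
        = 2 * ∫ z, (∫ y in Ioi |√(2 * τ) * z|, fin y) ∂(gaussianReal 0 1) := by
      rw [two_mul, h2]
      nth_rewrite 2 [h3]
      rw [← integral_add hAi hAi', ← integral_const_mul]
      congr 1; ext z
      exact integral_mul_oddExt_one_symm hfin _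
    linarith
  -- For `τ ≤ 0` the square root has the default value `0`, matching the branch `fin` of `heatSol`.
  -- The formula, and the regularity drawn from it, thus hold on all of `ℝ`.
  · have hs : √(2 * τ) = 0 := Real.sqrt_eq_zero_of_nonpos (by linarith)
    simp only [mass, heatSol, if_neg hτ, hs, zero_mul, abs_zero, integral_const, probReal_univ,
      smul_eq_mul, one_mul]
    exact integral_Ici_eq_integral_Ioi

theorem integrable_tail (hfin : IntegrableOn fin (Ici 0))
    (hfin0 : ∀ᵐ x ∂(volume.restrict (Ici (0 : ℝ))), 0 ≤ fin x) (s : ℝ) :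
    Integrable (fun z => ∫ y in Ioi |s * z|, fin y) (gaussianReal 0 1) := by
  refine Integrable.of_bound ((continuous_setIntegral_Ioi_abs hfin).comp
    (continuous_const_mul s)).aestronglyMeasurable (∫ y in Ioi 0, fin y)
    (Eventually.of_forall fun z => ?_)
  have := setIntegral_Ioi_mem hfin hfin0 (abs_nonneg (s * z))
  rw [Real.norm_of_nonneg this.1]
  exact this.2

theorem antitone_mass_heatSol (hfin : IntegrableOn fin (Ici 0))
    (hfin0 : ∀ᵐ x ∂(volume.restrict (Ici (0 : ℝ))), 0 ≤ fin x) :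
    Antitone (mass (heatSol fin)) := by
  intro τ σ h
  rw [mass_heatSol hfin, mass_heatSol hfin]
  refine integral_mono (integrable_tail hfin hfin0 _) (integrable_tail hfin hfin0 _) fun z => ?_
  refine setIntegral_Ioi_antitone hfin hfin0 (abs_nonneg _) ?_
  rw [abs_mul, abs_mul, abs_of_nonneg (Real.sqrt_nonneg _), abs_of_nonneg (Real.sqrt_nonneg _)]
  gcongr

theorem continuous_mass_heatSol (hfin : IntegrableOn fin (Ici 0))
    (hfin0 : ∀ᵐ x ∂(volume.restrict (Ici (0 : ℝ))), 0 ≤ fin x) :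
    Continuous (mass (heatSol fin)) := by
  have h : mass (heatSol fin)
      = fun τ => ∫ z, (∫ y in Ioi |√(2 * τ) * z|, fin y) ∂(gaussianReal 0 1) :=
    funext (mass_heatSol hfin)
  rw [h]
  have hc := continuous_setIntegral_Ioi_abs hfin
  refine continuous_of_dominated (bound := fun _ => ∫ y in Ioi 0, fin y)
    (fun τ => (integrable_tail hfin hfin0 _).aestronglyMeasurable) (fun τ => ?_)
    (integrable_const _) (Eventually.of_forall fun z => ?_)
  · refine Eventually.of_forall fun z => ?_
    have := setIntegral_Ioi_mem hfin hfin0 (abs_nonneg (√(2 * τ) * z))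
    rw [Real.norm_of_nonneg this.1]
    exact this.2
  · exact hc.comp (by fun_prop)

theorem mass_heatSol_pos (hfin : IntegrableOn fin (Ici 0))
    (hfin0 : ∀ᵐ x ∂(volume.restrict (Ici (0 : ℝ))), 0 ≤ fin x)
    (hpos : 0 < ∫ y in Ioi 0, fin y) (τ : ℝ) : 0 < mass (heatSol fin) τ := by
  rw [mass_heatSol hfin]
  have hc : Continuous fun z : ℝ => ∫ y in Ioi |√(2 * τ) * z|, fin y :=
    (continuous_setIntegral_Ioi_abs hfin).comp (continuous_const_mul _)
  rw [integral_pos_iff_support_of_nonneg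
    (fun z => (setIntegral_Ioi_mem hfin hfin0 (abs_nonneg _)).1) (integrable_tail hfin hfin0 _)]
  have hopen : IsOpen (Function.support fun z : ℝ => ∫ y in Ioi |√(2 * τ) * z|, fin y) :=
    hc.isOpen_support
  -- At `z = 0` the tail is the full mass of `fin`, so the open support is nonempty and has positive
  -- Gaussian measure.
  have hv := hopen.measure_pos volume ⟨0, by simpa using hpos.ne'⟩
  refine pos_iff_ne_zero.2 fun h => hv.ne' ?_
  exact gaussianReal_absolutelyContinuous' 0 one_ne_zero h

theorem mass_heatSol_le (hfin : IntegrableOn fin (Ici 0))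
    (hfin0 : ∀ᵐ x ∂(volume.restrict (Ici (0 : ℝ))), 0 ≤ fin x) (τ : ℝ) :
    mass (heatSol fin) τ ≤ ∫ y in Ioi 0, fin y := by
  rw [mass_heatSol hfin]
  refine (integral_mono (integrable_tail hfin hfin0 _) (integrable_const (∫ y in Ioi 0, fin y))
    fun z => (setIntegral_Ioi_mem hfin hfin0 (abs_nonneg _)).2).trans ?_
  simp

theorem isHeatFlow_heatSol (hfin : IntegrableOn fin (Ici 0))
    (hfin0 : ∀ᵐ x ∂(volume.restrict (Ici (0 : ℝ))), 0 ≤ fin x) :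
    IsHeatFlow fin (heatSol fin) where
  integrable := integrableOn_heatSol hfin
  nonneg := heatSol_nonneg hfin0
  sine_transform := fun _ hτ ξ => sine_transform_heatSol hfin hτ ξ
  antitone_mass := antitone_mass_heatSol hfin hfin0

end HeatSolution

/-! ### Derivatives of the heat kernel and integration by parts. -/

/-- The second space derivative, equivalently the time derivative, of the heat kernel. -/
def heatLaplacian (τ z : ℝ) : ℝ := (z ^ 2 / (4 * τ ^ 2) - 1 / (2 * τ)) * heatKernel τ z

theorem hasDerivAt_heatKernel_space (τ z : ℝ) :
    HasDerivAt (heatKernel τ) (-z / (2 * τ) * heatKernel τ z) z := by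
  have h1 : HasDerivAt (fun z : ℝ => -z ^ 2 / (4 * τ)) (-(2 * z) / (4 * τ)) z := by
    simpa using ((hasDerivAt_pow 2 z).fun_neg).div_const (4 * τ)
  refine (h1.exp.const_mul (√(4 * Real.pi * τ))⁻¹).congr_deriv ?_
  unfold heatKernel
  rcases eq_or_ne τ 0 with rfl | hτ
  · simp
  · field_simp; ring

theorem hasDerivAt_heatKernel_space_deriv {τ : ℝ} (hτ : τ ≠ 0) (z : ℝ) :
    HasDerivAt (fun z => -z / (2 * τ) * heatKernel τ z) (heatLaplacian τ z) z := by
  have h1 : HasDerivAt (fun z : ℝ => -z / (2 * τ)) (-1 / (2 * τ)) z :=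
    ((hasDerivAt_id z).fun_neg).div_const (2 * τ)
  refine (h1.mul (hasDerivAt_heatKernel_space τ z)).congr_deriv ?_
  unfold heatLaplacian
  field_simp
  ring

theorem hasDerivAt_heatKernel_time {τ : ℝ} (hτ : 0 < τ) (z : ℝ) :
    HasDerivAt (fun τ => heatKernel τ z) (heatLaplacian τ z) τ := by
  have hpos : 0 < 4 * Real.pi * τ := by positivity
  have h1 : HasDerivAt (fun τ : ℝ => 4 * Real.pi * τ) (4 * Real.pi) τ := by
    simpa using (hasDerivAt_id τ).const_mul (4 * Real.pi)
  have h2 := (h1.sqrt hpos.ne').fun_inv (Real.sqrt_pos.2 hpos).ne'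
  have h3 : HasDerivAt (fun τ : ℝ => -z ^ 2 / (4 * τ)) (z ^ 2 / (4 * τ ^ 2)) τ := by
    have h4 : HasDerivAt (fun τ : ℝ => 4 * τ) 4 τ := by
      simpa using (hasDerivAt_id τ).const_mul (4 : ℝ)
    refine ((hasDerivAt_const τ (-z ^ 2)).fun_div h4 (by positivity)).congr_deriv ?_
    field_simp
    ring
  refine (h2.mul h3.exp).congr_deriv ?_
  unfold heatLaplacian heatKernel
  have hs : √(4 * Real.pi * τ) ≠ 0 := (Real.sqrt_pos.2 hpos).ne'
  rw [Real.sq_sqrt hpos.le]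
  field_simp
  ring

theorem heatKernel_neg (τ z : ℝ) : heatKernel τ (-z) = heatKernel τ z := by
  simp [heatKernel]

theorem continuousOn_heatKernel : ContinuousOn (Function.uncurry heatKernel) (Ioi 0 ×ˢ univ) := by
  unfold heatKernel Function.uncurry
  refine ContinuousOn.mul (ContinuousOn.inv₀ (by fun_prop) ?_)
    (Real.continuous_exp.comp_continuousOn (ContinuousOn.div (by fun_prop) (by fun_prop) ?_))
  · rintro p ⟨hp, -⟩
    have : 0 < p.1 := hp
    positivity
  · rintro p ⟨hp, -⟩
    have : 0 < p.1 := hp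
    positivity

theorem continuousOn_heatLaplacian :
    ContinuousOn (Function.uncurry heatLaplacian) (Ioi 0 ×ˢ univ) := by
  refine ContinuousOn.mul (ContinuousOn.sub (ContinuousOn.div (by fun_prop) (by fun_prop) ?_)
    (ContinuousOn.div (by fun_prop) (by fun_prop) ?_)) continuousOn_heatKernel
  · rintro p ⟨hp, -⟩
    have : 0 < p.1 := hp
    positivity
  · rintro p ⟨hp, -⟩
    have : 0 < p.1 := hp
    positivity

theorem integrable_pow_mul_exp_neg_div {τ : ℝ} (hτ : 0 < τ) (n : ℕ) (a : ℝ) :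
    Integrable fun x : ℝ => |x - a| ^ n * Real.exp (-(x - a) ^ 2 / (4 * τ)) := by
  have h1 := (integrable_rpow_mul_exp_neg_mul_sq (b := 1 / (4 * τ)) (by positivity)
    (s := n) (by linarith [n.cast_nonneg (α := ℝ)])).norm
  refine (h1.comp_sub_right a).congr (Eventually.of_forall fun x => ?_)
  simp only [Real.rpow_natCast, norm_mul, norm_pow, Real.norm_eq_abs, Real.abs_exp]
  congr 2
  ring

/-- The prefactor is largest at `τ₀` and the exponential at `τ₁`; combining them gives an integrable
majorant uniform in `τ`. -/
theorem heatKernel_le_of_mem {τ₀ τ₁ τ : ℝ} (h₀ : 0 < τ₀) (h : τ ∈ Icc τ₀ τ₁) (z : ℝ) :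
    heatKernel τ z ≤ (√(4 * Real.pi * τ₀))⁻¹ * Real.exp (-z ^ 2 / (4 * τ₁)) := by
  have hτ : 0 < τ := h₀.trans_le h.1
  unfold heatKernel
  refine mul_le_mul ?_ (Real.exp_le_exp.2 ?_) (Real.exp_pos _).le (by positivity)
  · refine inv_anti₀ (by positivity) (Real.sqrt_le_sqrt ?_)
    exact mul_le_mul_of_nonneg_left h.1 (by positivity)
  · rw [neg_div, neg_div, neg_le_neg_iff]
    exact div_le_div_of_nonneg_left (sq_nonneg z) (by positivity) (by linarith [h.2])

theorem abs_heatLaplacian_le_of_mem {τ₀ τ₁ τ : ℝ} (h₀ : 0 < τ₀) (h : τ ∈ Icc τ₀ τ₁) (z : ℝ) :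
    |heatLaplacian τ z| ≤ (|z| ^ 2 / (4 * τ₀ ^ 2) + 1 / (2 * τ₀))
      * ((√(4 * Real.pi * τ₀))⁻¹ * Real.exp (-z ^ 2 / (4 * τ₁))) := by
  have hτ : 0 < τ := h₀.trans_le h.1
  rw [heatLaplacian, abs_mul, abs_of_nonneg (heatKernel_nonneg τ z)]
  refine mul_le_mul ?_ (heatKernel_le_of_mem h₀ h z) (heatKernel_nonneg τ z) (by positivity)
  refine (abs_sub _ _).trans ?_
  rw [abs_of_nonneg (by positivity), abs_of_nonneg (by positivity), sq_abs]
  have h1 := h.1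
  gcongr

theorem integrable_heatKernel_bound (τ₀ : ℝ) {τ₁ : ℝ} (h₁ : 0 < τ₁) (a : ℝ) :
    Integrable fun x : ℝ => (√(4 * Real.pi * τ₀))⁻¹ * Real.exp (-(x - a) ^ 2 / (4 * τ₁)) := by
  simpa using (integrable_pow_mul_exp_neg_div h₁ 0 a).const_mul (√(4 * Real.pi * τ₀))⁻¹

theorem integrable_heatLaplacian_bound (τ₀ : ℝ) {τ₁ : ℝ} (h₁ : 0 < τ₁) (a : ℝ) :
    Integrable fun x : ℝ => (|x - a| ^ 2 / (4 * τ₀ ^ 2) + 1 / (2 * τ₀))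
      * ((√(4 * Real.pi * τ₀))⁻¹ * Real.exp (-(x - a) ^ 2 / (4 * τ₁))) := by
  have h2 := (integrable_pow_mul_exp_neg_div h₁ 2 a).const_mul
    (1 / (4 * τ₀ ^ 2) * (√(4 * Real.pi * τ₀))⁻¹)
  have h0 := (integrable_heatKernel_bound τ₀ h₁ a).const_mul (1 / (2 * τ₀))
  refine (h2.add h0).congr (Eventually.of_forall fun x => ?_)
  simp only [Pi.add_apply]
  ring

theorem integrable_abs_mul_heatKernel {τ : ℝ} (hτ : 0 < τ) (a : ℝ) :
    Integrable fun x : ℝ => |x - a| * heatKernel τ (x - a) := by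
  refine ((integrable_pow_mul_exp_neg_div hτ 1 a).const_mul (√(4 * Real.pi * τ))⁻¹).congr
    (Eventually.of_forall fun x => ?_)
  simp only [heatKernel]
  ring

/-- Integration by parts against the heat kernel on the half-line. -/
theorem integral_heatLaplacian_mul {τ : ℝ} (hτ : 0 < τ) (a C : ℝ) {ψ ψ₁ ψ₂ : ℝ → ℝ}
    (hψ : ContinuousOn ψ (Ici 0)) (hψ₁ : ContinuousOn ψ₁ (Ici 0)) (hψ₂ : ContinuousOn ψ₂ (Ici 0))
    (hd : ∀ x ∈ Ioi (0 : ℝ), HasDerivAt ψ (ψ₁ x) x)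
    (hd₁ : ∀ x ∈ Ioi (0 : ℝ), HasDerivAt ψ₁ (ψ₂ x) x) (h0 : ψ 0 = 0)
    (hC : ∀ x ∈ Ici (0 : ℝ), |ψ x| ≤ C) (hC₂ : ∀ x ∈ Ici (0 : ℝ), |ψ₂ x| ≤ C) :
    ∫ x in Ioi (0 : ℝ), heatLaplacian τ (x - a) * ψ x
      = (∫ x in Ioi (0 : ℝ), heatKernel τ (x - a) * ψ₂ x) + heatKernel τ a * ψ₁ 0 := by
  have hC0 : 0 ≤ C := (abs_nonneg _).trans (hC 0 self_mem_Ici)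
  -- The first derivative is not assumed bounded, but bounded `ψ₂` gives linear growth, which the
  -- Gaussian absorbs.
  have hgrow : ∀ x ∈ Ici (0 : ℝ), |ψ₁ x| ≤ |ψ₁ 0| + C * (|x - a| + |a|) := by
    intro x hx
    have hx0 : 0 ≤ x := hx
    have h1 : ‖ψ₁ x - ψ₁ 0‖ ≤ C * (x - 0) := by
      refine norm_image_sub_le_of_norm_deriv_le_segment' (a := 0) (b := x) (f' := fun x => ψ₂ x)
        ?_ ?_ x ⟨hx0, le_rfl⟩
      · intro y hy
        rcases hy.1.eq_or_lt with rfl | hy0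
        · have hdw := hasDerivWithinAt_Ici_of_tendsto_deriv (f := ψ₁) (s := Ioi 0) (a := 0)
            (e := ψ₂ 0) (fun z hz => (hd₁ z hz).differentiableAt.differentiableWithinAt)
            ((hψ₁ 0 self_mem_Ici).mono Ioi_subset_Ici_self) self_mem_nhdsWithin
            (((hψ₂ 0 self_mem_Ici).mono Ioi_subset_Ici_self).tendsto.congr' (by
              filter_upwards [self_mem_nhdsWithin] with z hz
              exact (hd₁ z hz).deriv.symm))
          exact hdw.mono Icc_subset_Ici_self
        · exact (hd₁ y hy0).hasDerivWithinAt
      · intro y hy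
        exact hC₂ y hy.1
    rw [Real.norm_eq_abs, sub_zero] at h1
    have h2 : |ψ₁ x| ≤ |ψ₁ x - ψ₁ 0| + |ψ₁ 0| := by
      simpa using abs_add_le (ψ₁ x - ψ₁ 0) (ψ₁ 0)
    have h3 : x ≤ |x - a| + |a| := by
      have := abs_add_le (x - a) a
      rw [sub_add_cancel, abs_of_nonneg hx0] at this
      exact this
    have := mul_le_mul_of_nonneg_left h3 hC0
    linarith
  have hkc : Continuous fun x => heatKernel τ (x - a) :=
    continuous_iff_continuousAt.2 fun x =>
      ((hasDerivAt_heatKernel_space τ (x - a)).comp_sub_const x a).continuousAt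
  have hLc : Continuous fun x => heatLaplacian τ (x - a) := by
    unfold heatLaplacian
    fun_prop
  have hsm : ∀ {u : ℝ → ℝ}, ContinuousOn u (Ici 0) →
      AEStronglyMeasurable u (volume.restrict (Ioi (0 : ℝ))) := fun hu =>
    (hu.mono Ioi_subset_Ici_self).aestronglyMeasurable measurableSet_Ioi
  have hk : IntegrableOn (fun x => heatKernel τ (x - a)) (Ioi 0) :=
    (integrable_heatKernel_sub hτ a).integrableOn
  have hk1 : IntegrableOn (fun x => |x - a| * heatKernel τ (x - a)) (Ioi 0) :=
    (integrable_abs_mul_heatKernel hτ a).integrableOn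
  have hL : IntegrableOn (fun x => heatLaplacian τ (x - a)) (Ioi 0) :=
    ((integrable_heatLaplacian_bound τ hτ a).mono' hLc.aestronglyMeasurable
      (Eventually.of_forall fun x =>
        abs_heatLaplacian_le_of_mem hτ ⟨le_rfl, le_rfl⟩ _)).integrableOn
  have hmem : ∀ᵐ x ∂(volume.restrict (Ioi (0 : ℝ))), x ∈ Ici (0 : ℝ) := by
    filter_upwards [ae_restrict_mem measurableSet_Ioi] with x hx
    exact (mem_Ioi.1 hx).le
  have hLψ : IntegrableOn (fun x => heatLaplacian τ (x - a) * ψ x) (Ioi 0) :=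
    hL.mul_bdd (c := C) (hsm hψ) (by filter_upwards [hmem] with x hx using hC x hx)
  have hkψ : IntegrableOn (fun x => heatKernel τ (x - a) * ψ₂ x) (Ioi 0) :=
    hk.mul_bdd (c := C) (hsm hψ₂) (by filter_upwards [hmem] with x hx using hC₂ x hx)
  set W : ℝ → ℝ := fun x =>
    -(x - a) / (2 * τ) * heatKernel τ (x - a) * ψ x - heatKernel τ (x - a) * ψ₁ x with hW
  have hWc : ContinuousOn W (Ici 0) := by
    have : Continuous fun x : ℝ => -(x - a) / (2 * τ) * heatKernel τ (x - a) := by fun_prop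
    exact (this.continuousOn.mul hψ).sub (hkc.continuousOn.mul hψ₁)
  have hWd : ∀ x ∈ Ioi (0 : ℝ), HasDerivAt W
      (heatLaplacian τ (x - a) * ψ x - heatKernel τ (x - a) * ψ₂ x) x := by
    intro x hx
    have e1 := (hasDerivAt_heatKernel_space_deriv hτ.ne' (x - a)).comp_sub_const x a
    have e2 := (hasDerivAt_heatKernel_space τ (x - a)).comp_sub_const x a
    refine ((e1.mul (hd x hx)).sub (e2.mul (hd₁ x hx))).congr_deriv ?_
    ring
  have hWi : IntegrableOn W (Ioi 0) := by
    have hb := ((hk1.const_mul (C / (2 * τ))).add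
      ((hk.const_mul (|ψ₁ 0| + C * |a|)).add (hk1.const_mul C)))
    refine Integrable.mono' hb (hsm hWc) ?_
    filter_upwards [hmem] with x hx
    simp only [hW, Pi.add_apply]
    refine (norm_sub_le _ _).trans (add_le_add ?_ ?_)
    · rw [norm_mul, norm_mul, norm_div, norm_neg, Real.norm_of_nonneg (heatKernel_nonneg _ _),
        Real.norm_of_nonneg (by positivity : 0 ≤ 2 * τ), Real.norm_eq_abs, Real.norm_eq_abs]
      have := mul_le_mul_of_nonneg_left (hC x hx)
        (by have := heatKernel_nonneg τ (x - a); positivity :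
          0 ≤ |x - a| / (2 * τ) * heatKernel τ (x - a))
      refine this.trans (le_of_eq ?_)
      ring
    · rw [norm_mul, Real.norm_of_nonneg (heatKernel_nonneg _ _), Real.norm_eq_abs]
      have := mul_le_mul_of_nonneg_left (hgrow x hx) (heatKernel_nonneg τ (x - a))
      refine this.trans (le_of_eq ?_)
      ring
  -- Since `W` and `W'` are integrable, there is no boundary term at infinity. At `0` only
  -- `-heatKernel τ a * ψ₁ 0` remains, because `ψ 0 = 0`.
  have hWt : Tendsto W atTop (𝓝 0) :=
    tendsto_zero_of_hasDerivAt_of_integrableOn_Ioi hWd (hLψ.sub hkψ) hWi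
  have key := integral_Ioi_of_hasDerivAt_of_tendsto (hWc 0 self_mem_Ici) hWd (hLψ.sub hkψ) hWt
  rw [integral_sub hLψ hkψ] at key
  simp only [hW, h0, zero_sub, heatKernel_neg] at key
  linarith

/-! ### Test functions on the strip: extension, derivatives, slices. -/

/-- The retraction of the plane onto the strip `[0, T] × [0, ∞)`. -/
def clamp (T : ℝ) (p : ℝ × ℝ) : ℝ × ℝ := (max 0 (min p.1 T), max p.2 0)

theorem continuous_clamp (T : ℝ) : Continuous (clamp T) := by
  unfold clamp; fun_prop

theorem clamp_mem {T : ℝ} (hT : 0 ≤ T) (p : ℝ × ℝ) : clamp T p ∈ strip T :=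
  ⟨⟨le_max_left _ _, max_le hT (min_le_right _ _)⟩, le_max_right p.2 0⟩

theorem clamp_of_mem {T : ℝ} {p : ℝ × ℝ} (hp : p ∈ strip T) : clamp T p = p := by
  obtain ⟨⟨h1, h2⟩, h3⟩ := hp
  exact Prod.ext (by simp [clamp, h1, h2]) (by simpa [clamp] using h3)

theorem continuous_comp_clamp {T : ℝ} (hT : 0 ≤ T) {u : ℝ × ℝ → ℝ}
    (hu : ContinuousOn u (strip T)) : Continuous fun p => u (clamp T p) :=
  hu.comp_continuous (continuous_clamp T) (clamp_mem hT)

section TestFunction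

variable {T : ℝ} {φ : ℝ → ℝ → ℝ}

theorem IsTestFunction.continuousOn (hφ : IsTestFunction T φ) :
    ContinuousOn (fun p : ℝ × ℝ => φ p.1 p.2) (strip T) := by
  simpa [spaceDeriv, iteratedDerivWithin_zero] using hφ.continuousOn_spaceDeriv 0 (by norm_num)

theorem IsTestFunction.continuousOn_time (hφ : IsTestFunction T φ) :
    ContinuousOn (fun p : ℝ × ℝ => timeDeriv T φ p.1 p.2) (strip T) := by
  simpa [spaceDeriv, iteratedDerivWithin_zero] using hφ.continuousOn_mixedDeriv 0 (by norm_num)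

theorem IsTestFunction.hasDerivAt_space (hφ : IsTestFunction T φ) {t x : ℝ} (ht : t ∈ Icc 0 T)
    (hx : x ∈ Ioi (0 : ℝ)) : HasDerivAt (φ t) (spaceDeriv 1 φ t x) x := by
  have h := ((hφ.contDiffOn_space t ht).differentiableOn (by norm_num)) x (mem_Ioi.1 hx).le
  have := h.hasDerivWithinAt.hasDerivAt (Ici_mem_nhds hx)
  rwa [spaceDeriv, iteratedDerivWithin_one]

theorem IsTestFunction.hasDerivAt_space_deriv (hφ : IsTestFunction T φ) {t x : ℝ}
    (ht : t ∈ Icc 0 T) (hx : x ∈ Ioi (0 : ℝ)) :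
    HasDerivAt (spaceDeriv 1 φ t) (spaceDeriv 2 φ t x) x := by
  have h := ((hφ.contDiffOn_space t ht).differentiableOn_iteratedDerivWithin (m := 1)
    (by norm_num) (uniqueDiffOn_Ici 0)) x (mem_Ioi.1 hx).le
  have := h.hasDerivWithinAt.hasDerivAt (Ici_mem_nhds hx)
  rw [spaceDeriv, show (2 : ℕ) = 1 + 1 from rfl, iteratedDerivWithin_succ]
  exact this

theorem IsTestFunction.hasDerivAt_time (hφ : IsTestFunction T φ) {t x : ℝ} (ht : t ∈ Ioo 0 T)
    (hx : x ∈ Ici (0 : ℝ)) : HasDerivAt (fun s => φ s x) (timeDeriv T φ t x) t :=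
  ((hφ.differentiableOn_time x hx) t ⟨ht.1.le, ht.2.le⟩).hasDerivWithinAt.hasDerivAt
    (Icc_mem_nhds ht.1 ht.2)

theorem continuousOn_slice_space {u : ℝ × ℝ → ℝ} (hu : ContinuousOn u (strip T)) {t : ℝ}
    (ht : t ∈ Icc 0 T) : ContinuousOn (fun x => u (t, x)) (Ici 0) :=
  hu.comp (by fun_prop) fun _ hx => ⟨ht, hx⟩

theorem continuousOn_slice_time {u : ℝ × ℝ → ℝ} (hu : ContinuousOn u (strip T)) {x : ℝ}
    (hx : x ∈ Ici (0 : ℝ)) : ContinuousOn (fun t => u (t, x)) (Icc 0 T) :=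
  hu.comp (by fun_prop) fun _ ht => ⟨ht, hx⟩

end TestFunction

/-! ### The kernel along a time change, tested against `φ`. -/

/-- A smooth increasing time change with `τ 0 = 0` and derivative `τ'`. -/
structure IsTimeChange (τ τ' : ℝ → ℝ) : Prop where
  hasDerivAt : ∀ t, HasDerivAt τ (τ' t) t
  continuous_deriv : Continuous τ'
  strictMono : StrictMono τ
  zero : τ 0 = 0

section Evolution

variable {T : ℝ} {φ : ℝ → ℝ → ℝ} {τ τ' : ℝ → ℝ}

theorem IsTimeChange.pos (hτ : IsTimeChange τ τ') {t : ℝ} (ht : 0 < t) : 0 < τ t := by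
  rw [← hτ.zero]; exact hτ.strictMono ht

theorem IsTimeChange.continuous (hτ : IsTimeChange τ τ') : Continuous τ :=
  continuous_iff_continuousAt.2 fun t => (hτ.hasDerivAt t).continuousAt

/-- The integrand is `∂ₜ` of `heatKernel (τ t) (x - a) * φ t x`. Times start at `ε > 0` to avoid the
singularity of the kernel at `τ = 0`. -/
theorem IsTimeChange.integrable_evolution (hτ : IsTimeChange τ τ') (hφ : IsTestFunction T φ)
    (a : ℝ) {ε : ℝ} (hε : 0 < ε) (hεT : ε ≤ T) :
    Integrable (fun p : ℝ × ℝ => τ' p.1 * heatLaplacian (τ p.1) (p.2 - a) * φ p.1 p.2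
        + heatKernel (τ p.1) (p.2 - a) * timeDeriv T φ p.1 p.2)
      ((volume.restrict (Ioc ε T)).prod (volume.restrict (Ici (0 : ℝ)))) ∧
    ContinuousOn (fun p : ℝ × ℝ => τ' p.1 * heatLaplacian (τ p.1) (p.2 - a) * φ p.1 p.2
        + heatKernel (τ p.1) (p.2 - a) * timeDeriv T φ p.1 p.2) (Icc ε T ×ˢ Ici 0) := by
  obtain ⟨C, hC⟩ := hφ.bounded
  obtain ⟨B, hB⟩ := isCompact_Icc.exists_bound_of_continuousOn (s := Icc ε T)
    hτ.continuous_deriv.continuousOn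
  have hB0 : 0 ≤ B := (norm_nonneg _).trans (hB ε ⟨le_rfl, hεT⟩)
  have hsub : Icc ε T ×ˢ Ici 0 ⊆ strip T := prod_mono (Icc_subset_Icc_left hε.le) le_rfl
  have hmaps : MapsTo (fun p : ℝ × ℝ => (τ p.1, p.2 - a)) (Icc ε T ×ˢ Ici 0) (Ioi 0 ×ˢ univ) :=
    fun p hp => ⟨hτ.pos (hε.trans_le hp.1.1), mem_univ _⟩
  have hτc := hτ.continuous
  have hτ'c := hτ.continuous_deriv
  have hpc : ContinuousOn (fun p : ℝ × ℝ => (τ p.1, p.2 - a)) (Icc ε T ×ˢ Ici 0) := by fun_prop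
  have hcont : ContinuousOn (fun p : ℝ × ℝ => τ' p.1 * heatLaplacian (τ p.1) (p.2 - a) * φ p.1 p.2
        + heatKernel (τ p.1) (p.2 - a) * timeDeriv T φ p.1 p.2) (Icc ε T ×ˢ Ici 0) := by
    have h1 := continuousOn_heatLaplacian.comp hpc hmaps
    have h2 := continuousOn_heatKernel.comp hpc hmaps
    have h3 : ContinuousOn (fun p : ℝ × ℝ => τ' p.1) (Icc ε T ×ˢ Ici 0) := by fun_prop
    exact ((h3.mul h1).mul (hφ.continuousOn.mono hsub)).add
      (h2.mul (hφ.continuousOn_time.mono hsub))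
  refine ⟨?_, hcont⟩
  have hτT : 0 < τ T := hτ.pos (hε.trans_le hεT)
  have hb := ((integrable_heatLaplacian_bound (τ ε) hτT a).const_mul (B * C)).add
    ((integrable_heatKernel_bound (τ ε) hτT a).const_mul C)
  refine Integrable.mono' (hb.integrableOn.comp_snd (volume.restrict (Ioc ε T))) ?_ ?_
  · rw [Measure.prod_restrict]
    exact (hcont.mono (prod_mono Ioc_subset_Icc_self le_rfl)).aestronglyMeasurable
      (measurableSet_Ioc.prod measurableSet_Ici)
  · rw [Measure.prod_restrict]
    filter_upwards [ae_restrict_mem (measurableSet_Ioc.prod measurableSet_Ici)] with p hp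
    have hp1 : p.1 ∈ Icc ε T := ⟨hp.1.1.le, hp.1.2⟩
    have hps : p ∈ strip T := hsub ⟨hp1, hp.2⟩
    have hmem : τ p.1 ∈ Icc (τ ε) (τ T) :=
      ⟨hτ.strictMono.monotone hp1.1, hτ.strictMono.monotone hp1.2⟩
    have b1 := abs_heatLaplacian_le_of_mem (hτ.pos hε) hmem (p.2 - a)
    have b2 := heatKernel_le_of_mem (hτ.pos hε) hmem (p.2 - a)
    have b3 := hC p.1 hps.1 p.2 hps.2
    have b4 := hB p.1 hp1
    have hC0 : 0 ≤ C := (abs_nonneg _).trans b3.1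
    refine (norm_add_le _ _).trans (add_le_add ?_ ?_)
    · rw [norm_mul, norm_mul, Real.norm_eq_abs (heatLaplacian _ _), Real.norm_eq_abs (φ _ _)]
      have := mul_le_mul (mul_le_mul b4 b1 (abs_nonneg _) hB0) b3.1 (abs_nonneg _)
        (mul_nonneg hB0 ((abs_nonneg _).trans b1))
      refine this.trans (le_of_eq ?_)
      ring
    · rw [norm_mul, Real.norm_of_nonneg (heatKernel_nonneg _ _), Real.norm_eq_abs, mul_comm]
      exact mul_le_mul b3.2.1 b2 (heatKernel_nonneg _ _) hC0

theorem IsTimeChange.integral_evolution (hτ : IsTimeChange τ τ') (hφ : IsTestFunction T φ)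
    (a : ℝ) {ε : ℝ} (hε : 0 < ε) (hεT : ε ≤ T) :
    ∫ t in Ioc ε T, ∫ x in Ici (0 : ℝ), (τ' t * heatLaplacian (τ t) (x - a) * φ t x
        + heatKernel (τ t) (x - a) * timeDeriv T φ t x)
      = -∫ x in Ici (0 : ℝ), heatKernel (τ ε) (x - a) * φ ε x := by
  obtain ⟨hi, hc⟩ := hτ.integrable_evolution hφ a hε hεT
  have hswap := integral_integral_swap (f := fun t x => τ' t * heatLaplacian (τ t) (x - a) * φ t x
        + heatKernel (τ t) (x - a) * timeDeriv T φ t x) hi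
  rw [hswap, ← integral_neg]
  refine setIntegral_congr_fun measurableSet_Ici fun x hx => ?_
  have hsub : Icc ε T ⊆ Icc 0 T := Icc_subset_Icc_left hε.le
  have hcx : ContinuousOn (fun t => τ' t * heatLaplacian (τ t) (x - a) * φ t x
        + heatKernel (τ t) (x - a) * timeDeriv T φ t x) (Icc ε T) :=
    hc.comp (f := fun t => (t, x)) (by fun_prop) fun t ht => ⟨ht, hx⟩
  have hτc := hτ.continuous
  have hkc : ContinuousOn (fun t => heatKernel (τ t) (x - a) * φ t x) (Icc ε T) := by
    refine ContinuousOn.mul ?_ ((continuousOn_slice_time hφ.continuousOn hx).mono hsub)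
    exact continuousOn_heatKernel.comp (f := fun t => (τ t, x - a)) (by fun_prop)
      fun t ht => ⟨hτ.pos (hε.trans_le ht.1), mem_univ _⟩
  rw [← intervalIntegral.integral_of_le hεT,
    intervalIntegral.integral_eq_sub_of_hasDerivAt_of_le hεT hkc (fun t ht => ?_)
      (hcx.intervalIntegrable_of_Icc hεT), hφ.terminal x hx]
  · ring
  · have h1 := (hasDerivAt_heatKernel_time (hτ.pos (hε.trans ht.1)) (x - a)).comp t
      (hτ.hasDerivAt t)
    refine (h1.mul (hφ.hasDerivAt_time ⟨hε.trans ht.1, ht.2⟩ hx)).congr_deriv ?_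
    simp only [Function.comp]
    ring

/-- Moves the Laplacian from the kernel to `φ`. The boundary term is even in `a`, so it cancels when
the identities for `a = y` and `a = -y` are subtracted. -/
theorem IsTestFunction.integral_evolution_eq (hφ : IsTestFunction T φ) {s b t : ℝ} (hs : 0 < s)
    (ht : t ∈ Icc 0 T) (a : ℝ) :
    ∫ x in Ici (0 : ℝ), (b * heatLaplacian s (x - a) * φ t x
        + heatKernel s (x - a) * timeDeriv T φ t x)
      = (∫ x in Ici (0 : ℝ), heatKernel s (x - a) * (timeDeriv T φ t x + b * spaceDeriv 2 φ t x))
        + b * (heatKernel s a * spaceDeriv 1 φ t 0) := by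
  obtain ⟨C, hC⟩ := hφ.bounded
  have hc := continuousOn_slice_space hφ.continuousOn ht
  have hct := continuousOn_slice_space hφ.continuousOn_time ht
  have hc1 := continuousOn_slice_space (hφ.continuousOn_spaceDeriv 1 (by norm_num)) ht
  have hc2 := continuousOn_slice_space (hφ.continuousOn_spaceDeriv 2 le_rfl) ht
  have key := integral_heatLaplacian_mul hs a C hc hc1 hc2
    (fun x hx => hφ.hasDerivAt_space ht hx) (fun x hx => hφ.hasDerivAt_space_deriv ht hx)
    (hφ.dirichlet t ht) (fun x hx => (hC t ht x hx).1) (fun x hx => (hC t ht x hx).2.2)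
  rw [← integral_Ici_eq_integral_Ioi, ← integral_Ici_eq_integral_Ioi] at key
  have hk : IntegrableOn (fun x => heatKernel s (x - a)) (Ici 0) :=
    (integrable_heatKernel_sub hs a).integrableOn
  have hL : IntegrableOn (fun x => heatLaplacian s (x - a)) (Ici 0) := by
    refine ((integrable_heatLaplacian_bound s hs a).mono' ?_ (Eventually.of_forall fun x =>
        abs_heatLaplacian_le_of_mem hs ⟨le_rfl, le_rfl⟩ _)).integrableOn
    unfold heatLaplacian heatKernel
    fun_prop
  have hmem := ae_restrict_mem (μ := volume) (measurableSet_Ici (a := (0 : ℝ)))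
  have i1 : IntegrableOn (fun x => b * heatLaplacian s (x - a) * φ t x) (Ici 0) :=
    (hL.const_mul b).mul_bdd (c := C) (hc.aestronglyMeasurable measurableSet_Ici)
      (by filter_upwards [hmem] with x hx using (hC t ht x hx).1)
  have i2 : IntegrableOn (fun x => heatKernel s (x - a) * timeDeriv T φ t x) (Ici 0) :=
    hk.mul_bdd (c := C) (hct.aestronglyMeasurable measurableSet_Ici)
      (by filter_upwards [hmem] with x hx using (hC t ht x hx).2.1)
  have i3 : IntegrableOn (fun x => heatKernel s (x - a) * spaceDeriv 2 φ t x) (Ici 0) :=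
    hk.mul_bdd (c := C) (hc2.aestronglyMeasurable measurableSet_Ici)
      (by filter_upwards [hmem] with x hx using (hC t ht x hx).2.2)
  rw [integral_add i1 i2]
  simp_rw [mul_assoc b, mul_add, mul_left_comm _ b]
  rw [integral_add i2 (i3.const_mul b), integral_const_mul, integral_const_mul, key]
  ring

/-- The integrand obtained by testing the Dirichlet kernel with `∂ₜφ + τ' ∂ₓ²φ`. -/
def kernelTest (T : ℝ) (φ : ℝ → ℝ → ℝ) (τ τ' : ℝ → ℝ) (t y : ℝ) : ℝ :=
  ∫ x in Ici (0 : ℝ), dirichletKernel (τ t) x y *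
    (timeDeriv T φ t x + τ' t * spaceDeriv 2 φ t x)

theorem IsTimeChange.integral_kernelTest (hτ : IsTimeChange τ τ') (hφ : IsTestFunction T φ)
    (y : ℝ) {ε : ℝ} (hε : 0 < ε) (hεT : ε ≤ T) :
    ∫ t in Ioc ε T, kernelTest T φ τ τ' t y
      = -∫ x in Ici (0 : ℝ), dirichletKernel (τ ε) x y * φ ε x := by
  obtain ⟨C, hC⟩ := hφ.bounded
  have h1 := hτ.integral_evolution hφ y hε hεT
  have h2 := hτ.integral_evolution hφ (-y) hε hεT
  have hi1 := (hτ.integrable_evolution hφ y hε hεT).1.integral_prod_left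
  have hi2 := (hτ.integrable_evolution hφ (-y) hε hεT).1.integral_prod_left
  have hmem := ae_restrict_mem (μ := volume) (measurableSet_Ici (a := (0 : ℝ)))
  have hsplit : ∀ {s : ℝ} {F : ℝ → ℝ} {D : ℝ}, 0 < s → ContinuousOn F (Ici 0) →
      (∀ x ∈ Ici (0 : ℝ), |F x| ≤ D) → ∫ x in Ici (0 : ℝ), dirichletKernel s x y * F x
        = (∫ x in Ici (0 : ℝ), heatKernel s (x - y) * F x)
          - ∫ x in Ici (0 : ℝ), heatKernel s (x - -y) * F x := by
    intro s F D hs hF hD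
    have hi : ∀ a, IntegrableOn (fun x => heatKernel s (x - a) * F x) (Ici 0) := fun a =>
      (integrable_heatKernel_sub hs a).integrableOn.mul_bdd (c := D)
        (hF.aestronglyMeasurable measurableSet_Ici)
        (by filter_upwards [hmem] with x hx using hD x hx)
    rw [← integral_sub (hi y) (hi (-y))]
    congr 1; ext x
    rw [dirichletKernel, sub_neg_eq_add]; ring
  have hεmem : ε ∈ Icc 0 T := ⟨hε.le, hεT⟩
  rw [hsplit (hτ.pos hε) (continuousOn_slice_space hφ.continuousOn hεmem)
    (fun x hx => (hC ε hεmem x hx).1), neg_sub]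
  have h3 : ∫ t in Ioc ε T, kernelTest T φ τ τ' t y
      = (∫ t in Ioc ε T, ∫ x in Ici (0 : ℝ), (τ' t * heatLaplacian (τ t) (x - y) * φ t x
        + heatKernel (τ t) (x - y) * timeDeriv T φ t x))
        - ∫ t in Ioc ε T, ∫ x in Ici (0 : ℝ), (τ' t * heatLaplacian (τ t) (x - -y) * φ t x
        + heatKernel (τ t) (x - -y) * timeDeriv T φ t x) := by
    rw [← integral_sub hi1 hi2]
    refine setIntegral_congr_fun measurableSet_Ioc fun t ht => ?_
    have htm : t ∈ Icc 0 T := ⟨hε.le.trans ht.1.le, ht.2⟩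
    have hpos := hτ.pos (hε.trans ht.1)
    simp only
    rw [hφ.integral_evolution_eq hpos htm y, hφ.integral_evolution_eq hpos htm (-y),
      heatKernel_neg, kernelTest, hsplit (D := C + |τ' t| * C) hpos]
    · ring
    · exact (continuousOn_slice_space hφ.continuousOn_time htm).add
        (continuousOn_const.mul
          (continuousOn_slice_space (hφ.continuousOn_spaceDeriv 2 le_rfl) htm))
    · intro x hx
      refine (abs_add_le _ _).trans (add_le_add (hC t htm x hx).2.1 ?_)
      rw [abs_mul]
      exact mul_le_mul_of_nonneg_left (hC t htm x hx).2.2 (abs_nonneg _)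
  rw [h3, h1, h2]
  ring

/-- The Dirichlet kernel is an approximate identity. -/
theorem IsTimeChange.tendsto_integral_dirichletKernel (hτ : IsTimeChange τ τ') (hT : 0 < T)
    (hφ : IsTestFunction T φ) {y : ℝ} (hy : 0 < y) :
    Tendsto (fun ε => ∫ x in Ici (0 : ℝ), dirichletKernel (τ ε) x y * φ ε x) (𝓝[>] 0)
      (𝓝 (φ 0 y)) := by
  obtain ⟨C, hC⟩ := hφ.bounded
  set Φ : ℝ × ℝ → ℝ := fun p => φ (clamp T p).1 (clamp T p).2 with hΦ
  have hΦc : Continuous Φ := continuous_comp_clamp hT.le hφ.continuousOn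
  have hΦeq : ∀ t ∈ Icc 0 T, ∀ x ∈ Ici (0 : ℝ), Φ (t, x) = φ t x := by
    intro t ht x hx
    simp only [hΦ]
    rw [clamp_of_mem (⟨ht, hx⟩ : (t, x) ∈ strip T)]
  have hΦC : ∀ p, |Φ p| ≤ C := fun p =>
    (hC _ (clamp_mem hT.le p).1 _ (clamp_mem hT.le p).2).1
  have hev : ∀ᶠ ε in 𝓝[>] (0 : ℝ), ε ∈ Ioc 0 T := Ioc_mem_nhdsGT hT
  have heq : ∀ᶠ ε in 𝓝[>] (0 : ℝ),
      ∫ z, oddExt (fun x => Φ (ε, x)) (y + √(2 * τ ε) * z) ∂(gaussianReal 0 1)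
        = ∫ x in Ici (0 : ℝ), dirichletKernel (τ ε) x y * φ ε x := by
    filter_upwards [hev] with ε hε
    rw [← integral_dirichletKernel_mul (F := fun x => Φ (ε, x)) (hτ.pos hε.1) y
      (hΦc.comp (by fun_prop : Continuous fun x : ℝ => (ε, x))).measurable fun x _ => hΦC _]
    refine setIntegral_congr_fun measurableSet_Ici fun x hx => ?_
    rw [hΦeq ε ⟨hε.1.le, hε.2⟩ x hx]
  refine Tendsto.congr' heq ?_
  have hlim : φ 0 y = ∫ _z : ℝ, φ 0 y ∂(gaussianReal 0 1) := by simp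
  rw [hlim]
  refine tendsto_integral_filter_of_dominated_convergence (fun _ => 2 * C)
    (Eventually.of_forall fun ε => ?_) (Eventually.of_forall fun ε => Eventually.of_forall
      fun z => abs_oddExt_le (fun x _ => hΦC _) _) (integrable_const _)
    (Eventually.of_forall fun z => ?_)
  · exact ((measurable_oddExt (hΦc.comp (by fun_prop : Continuous fun x : ℝ =>
      (ε, x))).measurable).comp (by fun_prop)).aestronglyMeasurable
  · have hτc := hτ.continuous
    have hc : Continuous fun ε : ℝ => y + √(2 * τ ε) * z := by fun_prop
    have ht : Tendsto (fun ε : ℝ => y + √(2 * τ ε) * z) (𝓝[>] 0) (𝓝 y) := by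
      have := hc.tendsto 0
      simp only [hτ.zero, mul_zero, Real.sqrt_zero, zero_mul, add_zero] at this
      exact this.mono_left nhdsWithin_le_nhds
    have hΦt : Tendsto (fun ε : ℝ => Φ (ε, y + √(2 * τ ε) * z)) (𝓝[>] 0) (𝓝 (φ 0 y)) := by
      rw [← hΦeq 0 ⟨le_rfl, hT.le⟩ y hy.le]
      refine (hΦc.tendsto (0, y)).comp ?_
      exact (tendsto_id.mono_left nhdsWithin_le_nhds).prodMk_nhds ht
    refine hΦt.congr' ?_
    -- As `y > 0`, the shifted point is eventually positive, where the odd extension is the function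
    -- itself.
    filter_upwards [ht.eventually (lt_mem_nhds hy)] with ε hε
    rw [oddExt, indicator_of_mem (mem_Ici.2 hε.le),
      indicator_of_notMem (fun h => absurd (mem_Ici.1 h) (by linarith)), sub_zero]

end Evolution

/-! ### Construction of the clock and existence. -/

/-- Global solvability of `τ' = M(τ)`, `τ(0) = 0` for a continuous positive bounded `M`. -/
theorem exists_isTimeChange {M : ℝ → ℝ} (hM : Continuous M) (hpos : ∀ s, 0 < M s) {B : ℝ}
    (hB : ∀ s, M s ≤ B) : ∃ τ, IsTimeChange τ fun t => M (τ t) := by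
  -- Separation of variables: `τ` is the inverse of `G`. The bound `M ≤ B` makes the slope of `G` at
  -- least `1 / B`, so `G` is onto `ℝ` and `τ` is global.
  set G : ℝ → ℝ := fun s => ∫ r in (0 : ℝ)..s, (M r)⁻¹ with hG
  have hc : Continuous fun r => (M r)⁻¹ := hM.inv₀ fun s => (hpos s).ne'
  have hd : ∀ s, HasDerivAt G (M s)⁻¹ s := fun s =>
    intervalIntegral.integral_hasDerivAt_right (hc.intervalIntegrable 0 s)
      (hc.stronglyMeasurableAtFilter _ _) hc.continuousAt
  have hB0 : 0 < B := (hpos 0).trans_le (hB 0)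
  have hG0 : G 0 = 0 := by simp [hG]
  have hmono : StrictMono G := strictMono_of_deriv_pos fun s => by
    rw [(hd s).deriv]; exact inv_pos.2 (hpos s)
  have hmono' : Monotone fun s => G s - s / B := by
    have hd' : ∀ s, HasDerivAt (fun s => G s - s / B) ((M s)⁻¹ - 1 / B) s := fun s =>
      (hd s).fun_sub ((hasDerivAt_id s).div_const B)
    refine monotone_of_deriv_nonneg (fun s => (hd' s).differentiableAt) fun s => ?_
    rw [(hd' s).deriv, one_div]
    exact sub_nonneg.2 (inv_anti₀ (hpos s) (hB s))
  have hcont : Continuous G := continuous_iff_continuousAt.2 fun s => (hd s).continuousAt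
  have htop : Tendsto G atTop atTop := by
    refine tendsto_atTop_mono' atTop ?_ (tendsto_id.atTop_div_const hB0)
    filter_upwards [eventually_ge_atTop 0] with s hs
    have := hmono' hs
    simp only [hG0, zero_div, sub_zero] at this
    simp only [id]
    linarith
  have hbot : Tendsto G atBot atBot := by
    refine tendsto_atBot_mono' atBot ?_ (tendsto_id.atBot_div_const hB0)
    filter_upwards [eventually_le_atBot 0] with s hs
    have := hmono' hs
    simp only [hG0, zero_div, sub_zero] at this
    simp only [id]
    linarith
  set e : ℝ ≃o ℝ := hmono.orderIsoOfSurjective G (hcont.surjective htop hbot) with he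
  have heG : ∀ s, e s = G s := fun s => rfl
  have hGe : ∀ t, G (e.symm t) = t := fun t => by rw [← heG, e.apply_symm_apply]
  refine ⟨e.symm, fun t => ?_, hM.comp e.symm.continuous, e.symm.strictMono, ?_⟩
  · have := HasDerivAt.of_local_left_inverse (f := G) (g := e.symm) (a := t)
      e.symm.continuous.continuousAt (hd (e.symm t)) (inv_pos.2 (hpos _)).ne'
      (Eventually.of_forall hGe)
    rwa [inv_inv] at this
  · exact (e.symm_apply_eq).2 hG0.symm

section Existence

variable {T η : ℝ} {φ : ℝ → ℝ → ℝ} {τ τ' : ℝ → ℝ} {fin : ℝ → ℝ}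

/-- Uniform boundedness and joint measurability of the kernel test integrand. -/
theorem IsTimeChange.kernelTest_bound (hτ : IsTimeChange τ τ') (hT : 0 < T)
    (hφ : IsTestFunction T φ) :
    (∃ D, ∀ t ∈ Ioc 0 T, ∀ y, |kernelTest T φ τ τ' t y| ≤ D) ∧
      ∃ I : ℝ × ℝ → ℝ, StronglyMeasurable I ∧
        ∀ t ∈ Icc 0 T, ∀ y, I (t, y) = kernelTest T φ τ τ' t y := by
  obtain ⟨C, hC⟩ := hφ.bounded
  obtain ⟨B, hB⟩ := isCompact_Icc.exists_bound_of_continuousOn (s := Icc 0 T)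
    hτ.continuous_deriv.continuousOn
  have hτc := hτ.continuous
  have hτ'c := hτ.continuous_deriv
  set Z : ℝ × ℝ → ℝ := fun p => timeDeriv T φ (clamp T p).1 (clamp T p).2
    + τ' p.1 * spaceDeriv 2 φ (clamp T p).1 (clamp T p).2 with hZ
  have hZc : Continuous Z := by
    have h1 := continuous_comp_clamp hT.le hφ.continuousOn_time
    have h2 := continuous_comp_clamp hT.le (hφ.continuousOn_spaceDeriv 2 le_rfl)
    exact h1.add ((by fun_prop : Continuous fun p : ℝ × ℝ => τ' p.1).mul h2)
  have hZC : ∀ t ∈ Icc 0 T, ∀ x, |Z (t, x)| ≤ C + B * C := by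
    intro t ht x
    have hm := clamp_mem hT.le (t, x)
    obtain ⟨-, b1, b2⟩ := hC _ hm.1 _ hm.2
    refine (abs_add_le _ _).trans (add_le_add b1 ?_)
    rw [abs_mul]
    exact mul_le_mul (hB t ht) b2 (abs_nonneg _) ((norm_nonneg _).trans (hB t ht))
  have heq : ∀ t ∈ Icc 0 T, ∀ y, ∫ x in Ici (0 : ℝ), dirichletKernel (τ t) x y * Z (t, x)
      = kernelTest T φ τ τ' t y := by
    intro t ht y
    refine setIntegral_congr_fun measurableSet_Ici fun x hx => ?_
    simp only [hZ]
    rw [clamp_of_mem (⟨ht, hx⟩ : (t, x) ∈ strip T)]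
  -- The factor `2` is the loss in bounding the odd extension.
  refine ⟨⟨2 * (C + B * C), fun t ht y => ?_⟩,
    fun p => ∫ x in Ici (0 : ℝ), dirichletKernel (τ p.1) x p.2 * Z (p.1, x), ?_, heq⟩
  · have htm : t ∈ Icc 0 T := ⟨ht.1.le, ht.2⟩
    rw [← heq t htm, integral_dirichletKernel_mul (F := fun x => Z (t, x)) (hτ.pos ht.1) y
      (hZc.comp (by fun_prop : Continuous fun x : ℝ => (t, x))).measurable
      fun x _ => hZC t htm x]
    have hb : ∀ w, ‖oddExt (fun x => Z (t, x)) w‖ ≤ 2 * (C + B * C) := fun w =>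
      abs_oddExt_le (fun x _ => hZC t htm x) w
    refine (norm_integral_le_of_norm_le_const (Eventually.of_forall fun z => hb _)).trans ?_
    simp
  · refine StronglyMeasurable.integral_prod_right'
      (f := fun q : (ℝ × ℝ) × ℝ => dirichletKernel (τ q.1.1) q.2 q.1.2 * Z (q.1.1, q.2)) ?_
    have h1 : Measurable fun q : (ℝ × ℝ) × ℝ => dirichletKernel (τ q.1.1) q.2 q.1.2 :=
      measurable_dirichletKernel.comp (by fun_prop : Measurable fun q : (ℝ × ℝ) × ℝ =>
        (τ q.1.1, q.2, q.1.2))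
    exact (h1.mul (hZc.comp (by fun_prop : Continuous fun q : (ℝ × ℝ) × ℝ =>
      (q.1.1, q.2))).measurable).stronglyMeasurable

theorem IsTimeChange.integrableOn_kernelTest (hτ : IsTimeChange τ τ') (hT : 0 < T)
    (hφ : IsTestFunction T φ) (y : ℝ) :
    IntegrableOn (fun t => kernelTest T φ τ τ' t y) (Ioc 0 T) := by
  obtain ⟨⟨D, hD⟩, I, hI, hIeq⟩ := hτ.kernelTest_bound hT hφ
  have hmem := ae_restrict_mem (μ := volume) (measurableSet_Ioc (a := (0 : ℝ)) (b := T))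
  refine Integrable.of_bound ((hI.comp_measurable
    (by fun_prop : Measurable fun t : ℝ => (t, y))).aestronglyMeasurable.congr ?_) D ?_
  · filter_upwards [hmem] with t ht
    exact hIeq t ⟨ht.1.le, ht.2⟩ y
  · filter_upwards [hmem] with t ht
    exact hD t ht y

/-- Limit `ε → 0` of `IsTimeChange.integral_kernelTest`: the primitive is continuous, and the kernel
is an approximate identity at `y > 0`. -/
theorem IsTimeChange.integral_kernelTest_eq (hτ : IsTimeChange τ τ') (hT : 0 < T)
    (hφ : IsTestFunction T φ) {y : ℝ} (hy : 0 < y) :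
    ∫ t in Ioc 0 T, kernelTest T φ τ τ' t y = -φ 0 y := by
  have hi := hτ.integrableOn_kernelTest hT hφ y
  have hii : IntervalIntegrable (fun t => kernelTest T φ τ τ' t y) volume 0 T :=
    (intervalIntegrable_iff_integrableOn_Ioc_of_le hT.le).2 hi
  have hcont : ContinuousOn (fun ε => ∫ t in ε..T, kernelTest T φ τ τ' t y) (Icc 0 T) := by
    have := intervalIntegral.continuousOn_primitive_interval_left (f := fun t =>
      kernelTest T φ τ τ' t y) (μ := volume) (a := 0) (b := T) (by
        rw [uIcc_of_le hT.le, integrableOn_Icc_iff_integrableOn_Ioc]; exact hi)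
    rwa [uIcc_of_le hT.le] at this
  have h1 : Tendsto (fun ε => ∫ t in ε..T, kernelTest T φ τ τ' t y) (𝓝[>] 0)
      (𝓝 (∫ t in (0 : ℝ)..T, kernelTest T φ τ τ' t y)) := by
    refine (hcont 0 ⟨le_rfl, hT.le⟩).mono_left ?_
    rw [← nhdsWithin_Ioc_eq_nhdsGT hT]
    exact nhdsWithin_mono _ Ioc_subset_Icc_self
  have h2 := (hτ.tendsto_integral_dirichletKernel hT hφ hy).neg
  rw [← intervalIntegral.integral_of_le hT.le]
  refine tendsto_nhds_unique h1 (h2.congr' ?_)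
  filter_upwards [Ioc_mem_nhdsGT hT] with ε hε
  rw [intervalIntegral.integral_of_le hε.2, hτ.integral_kernelTest hφ y hε.1 hε.2]

theorem IsTimeChange.aestronglyMeasurable_heatSol (hτ : IsTimeChange τ τ')
    (hfin : IntegrableOn fin (Ici 0)) :
    AEStronglyMeasurable (Function.uncurry fun t x => heatSol fin (τ t) x)
      ((volume.restrict (Icc 0 T)).prod (volume.restrict (Ici (0 : ℝ)))) := by
  have hτc := hτ.continuous
  have h1 : Measurable fun q : (ℝ × ℝ) × ℝ => dirichletKernel (τ q.1.1) q.1.2 q.2 :=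
    measurable_dirichletKernel.comp (by fun_prop : Measurable fun q : (ℝ × ℝ) × ℝ =>
      (τ q.1.1, q.1.2, q.2))
  have h2 : AEStronglyMeasurable (fun p : ℝ × ℝ => ∫ y in Ici (0 : ℝ),
      dirichletKernel (τ p.1) p.2 y * fin y)
      ((volume.restrict (Icc 0 T)).prod (volume.restrict (Ici (0 : ℝ)))) :=
    AEStronglyMeasurable.integral_prod_right'
      (f := fun q : (ℝ × ℝ) × ℝ => dirichletKernel (τ q.1.1) q.1.2 q.2 * fin q.2)
      (h1.aestronglyMeasurable.mul hfin.aestronglyMeasurable.comp_snd)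
  refine h2.congr ?_
  have hne : ∀ᵐ t ∂(volume.restrict (Icc 0 T)), 0 < t := by
    have : ∀ᵐ t ∂(volume.restrict (Icc 0 T)), t ≠ 0 := by rw [ae_iff]; simp
    filter_upwards [this, ae_restrict_mem measurableSet_Icc] with t h1 h2
    exact lt_of_le_of_ne h2.1 h1.symm
  filter_upwards [Measure.quasiMeasurePreserving_fst.ae hne] with p hp
  simp only [Function.uncurry, heatSol, if_pos (hτ.pos hp)]

theorem IsTimeChange.integrable_heatSol (hτ : IsTimeChange τ τ')
    (hfin : IntegrableOn fin (Ici 0))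
    (hfin0 : ∀ᵐ x ∂(volume.restrict (Ici (0 : ℝ))), 0 ≤ fin x) :
    Integrable (Function.uncurry fun t x => heatSol fin (τ t) x)
      ((volume.restrict (Icc 0 T)).prod (volume.restrict (Ici (0 : ℝ)))) := by
  rw [integrable_prod_iff (hτ.aestronglyMeasurable_heatSol hfin)]
  refine ⟨Eventually.of_forall fun t => integrableOn_heatSol hfin (τ t), ?_⟩
  have h : Continuous fun t => mass (heatSol fin) (τ t) :=
    (continuous_mass_heatSol hfin hfin0).comp hτ.continuous
  refine (h.integrableOn_Icc (a := 0) (b := T)).congr (Eventually.of_forall fun t => ?_)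
  refine integral_congr_ae ?_
  filter_upwards [heatSol_nonneg hfin0 (τ t)] with x hx
  exact (Real.norm_of_nonneg hx).symm

/-- Since `τ'` is `η / 3` times the mass, the two time integrals merge into one with test factor
`∂ₜφ + τ' ∂ₓ²φ`. Fubini transfers it to the kernel, leaving `fin` integrated against `-φ(0, ·)`. -/
theorem isVeryWeakSolution_heatSol (hT : 0 < T) (hfin : IntegrableOn fin (Ici 0))
    (hfin0 : ∀ᵐ x ∂(volume.restrict (Ici (0 : ℝ))), 0 ≤ fin x)
    (hτ : IsTimeChange τ fun t => η / 3 * mass (heatSol fin) (τ t)) :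
    IsVeryWeakSolution η T fin fun t x => heatSol fin (τ t) x := by
  set f : ℝ → ℝ → ℝ := fun t x => heatSol fin (τ t) x with hf
  have hfi : Integrable (Function.uncurry f)
      ((volume.restrict (Icc 0 T)).prod (volume.restrict (Ici (0 : ℝ)))) :=
    hτ.integrable_heatSol hfin hfin0
  have hmass : ∀ t, mass f t = mass (heatSol fin) (τ t) := fun t => rfl
  have hmc : Continuous (mass f) :=
    (continuous_mass_heatSol hfin hfin0).comp hτ.continuous
  have hmul : ∀ {u : ℝ → ℝ → ℝ} {C : ℝ}, ContinuousOn (fun p : ℝ × ℝ => u p.1 p.2) (strip T) →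
      (∀ t ∈ Icc 0 T, ∀ x ∈ Ici (0 : ℝ), |u t x| ≤ C) →
      Integrable (fun p : ℝ × ℝ => f p.1 p.2 * u p.1 p.2)
        ((volume.restrict (Icc 0 T)).prod (volume.restrict (Ici (0 : ℝ)))) := by
    intro u C hu hC
    refine hfi.mul_bdd (c := C) ?_ ?_
    · rw [Measure.prod_restrict]
      exact hu.aestronglyMeasurable (measurableSet_Icc.prod measurableSet_Ici)
    · rw [Measure.prod_restrict]
      filter_upwards [ae_restrict_mem (measurableSet_Icc.prod measurableSet_Ici)] with p hp
      exact hC p.1 hp.1 p.2 hp.2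
  have hdiff : ∀ φ, IsTestFunction T φ → IntegrableOn
      (fun t => mass f t * ∫ x in Ici (0 : ℝ), f t x * spaceDeriv 2 φ t x) (Icc 0 T) := by
    intro φ hφ
    obtain ⟨C, hC⟩ := hφ.bounded
    obtain ⟨B, hB⟩ := isCompact_Icc.exists_bound_of_continuousOn (s := Icc 0 T) hmc.continuousOn
    refine (hmul (hφ.continuousOn_spaceDeriv 2 le_rfl)
      fun t ht x hx => (hC t ht x hx).2.2).integral_prod_left.bdd_mul (c := B)
      hmc.aestronglyMeasurable ?_
    filter_upwards [ae_restrict_mem measurableSet_Icc] with t ht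
    exact hB t ht
  refine ⟨?_, hdiff, fun φ hφ => ?_⟩
  · rw [IntegrableOn, volume_restrict_strip]
    exact hfi
  obtain ⟨C, hC⟩ := hφ.bounded
  have hi1 := hmul hφ.continuousOn_time fun t ht x hx => (hC t ht x hx).2.1
  have hi2 := hmul (hφ.continuousOn_spaceDeriv 2 le_rfl) fun t ht x hx => (hC t ht x hx).2.2
  set κ : ℝ → ℝ → ℝ := kernelTest T φ τ fun t => η / 3 * mass (heatSol fin) (τ t) with hκ
  have e1 : (∫ t in Icc 0 T, ∫ x in Ici (0 : ℝ), f t x * timeDeriv T φ t x)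
      + η / 3 * (∫ t in Icc 0 T, mass f t * ∫ x in Ici (0 : ℝ), f t x * spaceDeriv 2 φ t x)
      = ∫ t in Ioc 0 T, ∫ y in Ici (0 : ℝ), fin y * κ t y := by
    rw [← integral_const_mul, ← integral_add hi1.integral_prod_left ((hdiff φ hφ).const_mul _),
      integral_Icc_eq_integral_Ioc]
    refine setIntegral_congr_ae measurableSet_Ioc ?_
    have hae : ∀ᵐ t ∂(volume.restrict (Ioc 0 T)),
        IntegrableOn (fun x => f t x * timeDeriv T φ t x) (Ici 0) ∧
        IntegrableOn (fun x => f t x * spaceDeriv 2 φ t x) (Ici 0) :=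
      ae_restrict_of_ae_restrict_of_subset Ioc_subset_Icc_self
        (hi1.prod_right_ae.and hi2.prod_right_ae)
    filter_upwards [(ae_restrict_iff' measurableSet_Ioc).1 hae] with t hit ht
    obtain ⟨j1, j2⟩ := hit ht
    have htm : t ∈ Icc 0 T := ⟨ht.1.le, ht.2⟩
    have hZ := integral_heatSol_mul (hτ.pos ht.1) hfin (F := fun x =>
      timeDeriv T φ t x + η / 3 * mass (heatSol fin) (τ t) * spaceDeriv 2 φ t x)
      (C := C + |η / 3 * mass (heatSol fin) (τ t)| * C)
      (((continuousOn_slice_space hφ.continuousOn_time htm).add (continuousOn_const.mul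
        (continuousOn_slice_space (hφ.continuousOn_spaceDeriv 2 le_rfl) htm))).aestronglyMeasurable
          measurableSet_Ici)
      (fun x hx => by
        refine (abs_add_le _ _).trans (add_le_add (hC t htm x hx).2.1 ?_)
        rw [abs_mul]
        exact mul_le_mul_of_nonneg_left (hC t htm x hx).2.2 (abs_nonneg _))
    refine Eq.trans ?_ hZ
    rw [← mul_assoc, ← integral_const_mul, ← integral_add j1 (j2.const_mul _), hmass]
    congr 1; ext x
    simp only [hf]
    ring
  obtain ⟨⟨D, hD⟩, I, hI, hIeq⟩ := hτ.kernelTest_bound hT hφ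
  have hprod : Integrable (Function.uncurry fun t y => fin y * κ t y)
      ((volume.restrict (Ioc 0 T)).prod (volume.restrict (Ici (0 : ℝ)))) := by
    have hmem : ∀ᵐ p ∂((volume.restrict (Ioc 0 T)).prod (volume.restrict (Ici (0 : ℝ)))),
        p.1 ∈ Ioc 0 T :=
      Measure.quasiMeasurePreserving_fst.ae (ae_restrict_mem measurableSet_Ioc)
    refine (hfin.comp_snd (volume.restrict (Ioc 0 T))).mul_bdd (c := D)
      (hI.aestronglyMeasurable.congr ?_) ?_
    · filter_upwards [hmem] with p hp
      exact hIeq p.1 ⟨hp.1.le, hp.2⟩ p.2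
    · filter_upwards [hmem] with p hp
      exact hD p.1 hp p.2
  rw [e1, integral_integral_swap hprod, integral_Ici_eq_integral_Ioi, integral_Ici_eq_integral_Ioi,
    add_eq_zero_iff_eq_neg, ← integral_neg]
  refine setIntegral_congr_fun measurableSet_Ioi fun y hy => ?_
  rw [integral_const_mul, hκ, hτ.integral_kernelTest_eq hT hφ hy, mul_neg]

theorem isVeryWeakSolution_zero (hfin : ∀ᵐ x ∂(volume.restrict (Ici (0 : ℝ))), fin x = 0) :
    IsVeryWeakSolution η T fin fun _ _ => 0 where
  integrable := integrable_zero _ _ _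
  integrable_diffusion := fun φ _ => by simp [mass]
  weak_eq := fun φ _ => by
    have : ∫ x in Ici (0 : ℝ), fin x * φ 0 x = 0 := by
      refine integral_eq_zero_of_ae ?_
      filter_upwards [hfin] with x hx
      simp [hx]
    simp [mass, this]

theorem exists_isVeryWeakSolution (hη : 0 < η) (hT : 0 < T) (hfin : IntegrableOn fin (Ici 0))
    (hfin0 : ∀ᵐ x ∂(volume.restrict (Ici (0 : ℝ))), 0 ≤ fin x) :
    ∃ f, IsNonnegative T f ∧ IsVeryWeakSolution η T fin f := by
  have hc : 0 < η / 3 := by positivity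
  have h0 : 0 ≤ ∫ y in Ici (0 : ℝ), fin y := integral_nonneg_of_ae hfin0
  rcases h0.eq_or_lt with h | hpos
  -- With zero initial mass `M` vanishes and `1 / M` is unavailable; but then `fin = 0` almost
  -- everywhere and the zero function is a solution.
  · refine ⟨fun _ _ => 0, Eventually.of_forall fun _ => le_rfl, isVeryWeakSolution_zero ?_⟩
    exact (integral_eq_zero_iff_of_nonneg_ae hfin0 hfin).1 h.symm
  · rw [integral_Ici_eq_integral_Ioi] at hpos
    obtain ⟨τ, hτ⟩ := exists_isTimeChange
      (M := fun s => η / 3 * mass (heatSol fin) s) (B := η / 3 * ∫ y in Ioi (0 : ℝ), fin y)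
      (continuous_const.mul (continuous_mass_heatSol hfin hfin0))
      (fun s => mul_pos hc (mass_heatSol_pos hfin hfin0 hpos s))
      (fun s => mul_le_mul_of_nonneg_left (mass_heatSol_le hfin hfin0 s) hc.le)
    refine ⟨fun t x => heatSol fin (τ t) x, ?_, isVeryWeakSolution_heatSol hT hfin hfin0 hτ⟩
    rw [IsNonnegative, volume_restrict_strip]
    -- Non-negativity on slices passes to the strip through `∫ (|u| - u) = 0`.
    have hneg : Integrable (fun p : ℝ × ℝ =>
        |heatSol fin (τ p.1) p.2| - heatSol fin (τ p.1) p.2)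
        ((volume.restrict (Icc 0 T)).prod (volume.restrict (Ici (0 : ℝ)))) :=
      (hτ.integrable_heatSol hfin hfin0).abs.sub (hτ.integrable_heatSol hfin hfin0)
    have hz : ∫ p : ℝ × ℝ, (|heatSol fin (τ p.1) p.2| - heatSol fin (τ p.1) p.2)
        ∂((volume.restrict (Icc 0 T)).prod (volume.restrict (Ici (0 : ℝ)))) = 0 := by
      rw [integral_prod _ hneg]
      refine integral_eq_zero_of_ae (Eventually.of_forall fun t => integral_eq_zero_of_ae ?_)
      filter_upwards [heatSol_nonneg hfin0 (τ t)] with x hx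
      simp [abs_of_nonneg hx]
    have := (integral_eq_zero_iff_of_nonneg (fun p => sub_nonneg.2 (le_abs_self _)) hneg).1 hz
    filter_upwards [this] with p hp
    have hp' : |heatSol fin (τ p.1) p.2| = heatSol fin (τ p.1) p.2 := sub_eq_zero.1 hp
    rw [← hp']
    exact abs_nonneg _

end Existence

end NonlocalDiffusion

end

theorem mainTheorem2 (η : ℝ) (hη : 0 < η) (T : ℝ) (hT : 0 < T) (fin : ℝ → ℝ)
    (hfin : IntegrableOn fin (Ici 0))
    (hfin_nonneg : ∀ᵐ x ∂(volume.restrict (Ici (0 : ℝ))), 0 ≤ fin x) :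
    ∃ f : ℝ → ℝ → ℝ,
      (NonlocalDiffusion.IsNonnegative T f ∧
        NonlocalDiffusion.IsVeryWeakSolution η T fin f) ∧
      ∀ g : ℝ → ℝ → ℝ,
        NonlocalDiffusion.IsNonnegative T g →
        NonlocalDiffusion.IsVeryWeakSolution η T fin g →
        ∀ᵐ p : ℝ × ℝ ∂(volume.restrict (NonlocalDiffusion.strip T)),
          g p.1 p.2 = f p.1 p.2 := by
  obtain ⟨f, hf0, hf⟩ := NonlocalDiffusion.exists_isVeryWeakSolution hη hT hfin hfin_nonneg
  exact ⟨f, ⟨hf0, hf⟩, fun g hg0 hg =>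
    hf.ae_eq hη hT hfin (NonlocalDiffusion.isHeatFlow_heatSol hfin hfin_nonneg) hf0 hg hg0⟩
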